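/- Let $(M,g)$ be a compact connected smooth Riemannian manifold (without boundary), and let $\mathcal E\to M$ be a smooth real vector bundle of finite rank with a smooth fibre metric $\langle\,,\rangle$ and a smooth connection $\nabla$ compatible with $\langle\,,\rangle$. For $p,q\in\mathbb R$ the vertical $(p,q)$-energy of a smooth section $\sigma$ of $\mathcal E$ is $$E^v_{p,q}(\sigma)=\frac12\int_M\frac{1}{(1+|\sigma|^2)^{p}}\sum_i\Bigl(|\nabla_{E_i}\sigma|^2+q\,\langle\nabla_{E_i}\sigma,\sigma\rangle^2\Bigr)\operatorname{vol}(g),$$ where $(E_i)$ is an orthonormal tangent frame at each point. The section $\sigma$ is called $(p,q)$-harmonic if $\frac{d}{dt}\big|_{t=0}E^v_{p,q}(\sigma_t)=0$ for every smooth variation $\sigma_t$ $(t\in\mathbb R)$ of $\sigma=\sigma_0$ through sections of $\mathcal E$; it is called parallel if $\nabla\sigma=0$. For $r\in\mathbb R$, $\sigma$ is called $r$-Riemannian if $r|\sigma(x)|^2\ge-1$ for all $x\in M$, and strictly $r$-Riemannian if in addition $r|\sigma(x)|^2>-1$ for some $x\in M$. For $\nu>0$ define $\varrho_\nu\colon[-4,\infty)\to\mathbb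 R$ by $$\varrho_\nu(p)=\begin{cases}-1-p,&-4\le p\le-1,\\ 0,&-1\le p\le2,\\ \nu(2-p)/2,&p\ge2.\end{cases}$$ Theorem 4.6. Let $\sigma$ be a smooth section of $\mathcal E$, let $p\ge-4$ and $q\ge\varrho_\nu(p)$, and suppose that either (a) $\nu>1$ and $\sigma$ is $\nu(1-p)$-Riemannian; or (b) $\nu=1$ and $\sigma$ is strictly $(1-p)$-Riemannian. Then $\sigma$ is $(p,q)$-harmonic if and only if $\sigma$ is parallel. -/

import Mathlib

open Bundle MeasureTheory
open scoped Manifold ContDiff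

noncomputable section

namespace PQHarmonic

section Volume

variable {n : ℕ} {M : Type*} [TopologicalSpace M] [ChartedSpace (EuclideanSpace ℝ (Fin n)) M]
  [RiemannianBundle (fun x : M ↦ TangentSpace (𝓡 n) x)]

/-- The coordinate vector `∂ᵢ` of the preferred chart around `x₀`, at the point of `M` whose
coordinates in this chart are `y`. -/
def coordVector (x₀ : M) (y : EuclideanSpace ℝ (Fin n)) (i : Fin n) :
    TangentSpace (𝓡 n) ((extChartAt (𝓡 n) x₀).symm y) :=
  mfderiv 𝓘(ℝ, EuclideanSpace ℝ (Fin n)) (𝓡 n) (extChartAt (𝓡 n) x₀).symm y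
    (EuclideanSpace.single i (1 : ℝ) : EuclideanSpace ℝ (Fin n))

/-- The matrix `gᵢⱼ = g(∂ᵢ, ∂ⱼ)` of the Riemannian metric in the preferred chart around `x₀`. -/
def gramMatrix (x₀ : M) (y : EuclideanSpace ℝ (Fin n)) : Matrix (Fin n) (Fin n) ℝ :=
  Matrix.of fun i j ↦ inner ℝ (coordVector x₀ y i) (coordVector x₀ y j)

/-- The Riemannian measure `√(det gᵢⱼ) dy¹ ⋯ dyⁿ` of the domain of the preferred chart around `x₀`,
regarded as a measure on `M` that vanishes outside this domain. -/
def chartVolume [MeasurableSpace M] (x₀ : M) : Measure M :=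
  (((volume : Measure (EuclideanSpace ℝ (Fin n))).restrict
      (extChartAt (𝓡 n) x₀).target).withDensity
    fun y ↦ ENNReal.ofReal (Real.sqrt (gramMatrix x₀ y).det)).map (extChartAt (𝓡 n) x₀).symm

variable (n M) in
/-- The Riemannian measure `vol(g)`. The measures `chartVolume x₀` agree on the overlaps of their
chart domains, so that their least upper bound is the measure on `M` which restricts to each of
them. -/
def riemannianVolume [MeasurableSpace M] : Measure M :=
  ⨆ x₀ : M, chartVolume (n := n) x₀

end Volume

section Sections

variable {M : Type*} {V : M → Type*} [∀ x, NormedAddCommGroup (V x)]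

/-- `σ` is `q`-Riemannian: `q |σ(x)|² ≥ -1` for all `x`. -/
def IsQRiemannian (q : ℝ) (σ : Π x : M, V x) : Prop :=
  ∀ x, -1 ≤ q * ‖σ x‖ ^ 2

/-- `σ` is strictly `q`-Riemannian: it is `q`-Riemannian and `q |σ(x)|² > -1` for some `x`. -/
def IsStrictlyQRiemannian (q : ℝ) (σ : Π x : M, V x) : Prop :=
  IsQRiemannian q σ ∧ ∃ x, -1 < q * ‖σ x‖ ^ 2

end Sections

/-- The restriction of `h_{p,q}` to vertical vectors at the point `e` of the bundle, where the
vertical space at `e` is identified with the fibre through `e` (this is what the connection map `K`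
does): `w(e)ᵖ (⟨a, b⟩ + q ⟨a, e⟩ ⟨b, e⟩)` with `w(e) = 1 / (1 + |e|²)`. -/
def verticalMetric {W : Type*} [NormedAddCommGroup W] [InnerProductSpace ℝ W]
    (p q : ℝ) (e a b : W) : ℝ :=
  (1 / (1 + ‖e‖ ^ 2)) ^ p * (inner ℝ a b + q * inner ℝ a e * inner ℝ b e)

section Energy

variable {n : ℕ} {M : Type*} [TopologicalSpace M] [ChartedSpace (EuclideanSpace ℝ (Fin n)) M]
  [IsManifold (𝓡 n) ∞ M]
  [RiemannianBundle (fun x : M ↦ TangentSpace (𝓡 n) x)]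
  {F : Type*} [NormedAddCommGroup F] [NormedSpace ℝ F]
  {V : M → Type*} [TopologicalSpace (TotalSpace F V)]
  [∀ x, NormedAddCommGroup (V x)] [∀ x, InnerProductSpace ℝ (V x)] [FiberBundle F V]

/-- `σ` is parallel: `∇σ = 0`. -/
def IsParallel (cov : CovariantDerivative (𝓡 n) F V) (σ : Π x : M, V x) : Prop :=
  ∀ x, cov σ x = 0

/-- The finite-dimensionality of the tangent spaces. -/
instance finiteDimensional_tangentSpace (x : M) :
    FiniteDimensional ℝ (TangentSpace (𝓡 n) x) :=
  inferInstanceAs (FiniteDimensional ℝ (EuclideanSpace ℝ (Fin n)))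

/-- `|dᵛσ|² = ∑ᵢ h_{p,q}(dᵛσ(Eᵢ), dᵛσ(Eᵢ))` for an orthonormal basis `(Eᵢ)` of the tangent space at
`x`. The connection map sends the vertical part `dᵛσ(X)` of `dσ(X)` to `∇_X σ`, which Mathlib writes
as `cov σ x X`. -/
def verticalDensity (cov : CovariantDerivative (𝓡 n) F V) (p q : ℝ) (σ : Π x : M, V x)
    (x : M) : ℝ :=
  ∑ i, verticalMetric p q (σ x)
    (cov σ x (stdOrthonormalBasis ℝ (TangentSpace (𝓡 n) x) i))
    (cov σ x (stdOrthonormalBasis ℝ (TangentSpace (𝓡 n) x) i))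

/-- The vertical `(p,q)`-energy `½ ∫_M |dᵛσ|² vol(g)`. -/
def verticalEnergy [MeasurableSpace M] (cov : CovariantDerivative (𝓡 n) F V) (p q : ℝ)
    (σ : Π x : M, V x) : ℝ :=
  1 / 2 * ∫ x, verticalDensity cov p q σ x ∂(riemannianVolume n M)

variable (F) in
/-- `(x, t) ↦ s t x` is a smooth variation of `σ = s 0` through sections. -/
def IsSmoothVariation (n : ℕ) {M : Type*} [TopologicalSpace M]
    [ChartedSpace (EuclideanSpace ℝ (Fin n)) M]
    {V : M → Type*} [TopologicalSpace (TotalSpace F V)]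
    [∀ x, NormedAddCommGroup (V x)] [∀ x, InnerProductSpace ℝ (V x)] [FiberBundle F V]
    (σ : Π x : M, V x) (s : ℝ → Π x : M, V x) : Prop :=
  s 0 = σ ∧
    ContMDiff ((𝓡 n).prod 𝓘(ℝ, ℝ)) ((𝓡 n).prod 𝓘(ℝ, F)) ∞
      (fun z : M × ℝ ↦ TotalSpace.mk' F z.1 (s z.2 z.1))

/-- `σ` is a `(p,q)`-harmonic section (for compact `M`): it is a stationary point of the vertical
`(p,q)`-energy with respect to all smooth variations through sections. -/
def IsPQHarmonic [MeasurableSpace M] (cov : CovariantDerivative (𝓡 n) F V) (p q : ℝ)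
    (σ : Π x : M, V x) : Prop :=
  ∀ s : ℝ → Π x : M, V x, IsSmoothVariation F n σ s →
    HasDerivAt (fun t ↦ verticalEnergy cov p q (s t)) 0 0

end Energy

/-- The cut-off function `ϱ_ν` on `[-4, ∞)` (only its values there matter). -/
def cutoff (ν p : ℝ) : ℝ :=
  if p ≤ -1 then -1 - p else if p ≤ 2 then 0 else ν * (2 - p) / 2

end PQHarmonic

end

/-! Harmonic implies parallel. The energy is tested on the single variation `(1 + t exp(K|σ|²)) σ`
with `K = 2|q|`. By metric compatibility its density depends only on `t`, `|σ|`, `b = |∇σ|²` and `c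
= ∑ᵢ⟨∇ᵢσ, σ⟩²`. Differentiation at `t = 0` gives, up to a positive factor, `(1 + (1-p)|σ|²) b + κ
c`, where `κ` depends on `|σ|²`, `p`, `q` and `K` (`deriv_radialDensity`). The scaling variation `K
= 0` would give `κ = q(2 + (2-p)|σ|²)`, which can be negative when `q < 0`; the exponential weight
repairs this. The curvature bound on `σ` and the cut-off make both coefficients nonnegative
(`cutoff_estimates`), so a vanishing integral forces `(1 + (1-p)|σ|²)|∇σ|² = 0` everywhere
(`first_variation_eq_zero`). For `ν > 1` the factor is positive. For `ν = 1` it is positive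
somewhere; `|σ|²` is locally constant where it is positive, and connectedness spreads the positivity
over `M`.

Parallel implies harmonic. If `∇σ = 0`, then `∇σ_t = O(t)` for every smooth variation, hence the
density is `O(t²)`, uniformly by compactness. So the energy is `O(t²)` and has derivative zero
(`isPQHarmonic_of_isParallel`).

Both directions use that the Riemannian measure is finite; the first also uses that it charges
nonempty open sets. -/

namespace PQHarmonic

open Filter Topology Set

/-! ### Metric traces of bilinear forms and their continuity -/

section Trace

/-- The trace of a bilinear form with respect to an orthonormal basis, computed in an arbitrary
basis `v` with the help of the inverse Gram matrix. -/
theorem sum_orthonormalBasis_eq_gram_inv {E ι κ : Type*} [NormedAddCommGroup E]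
    [InnerProductSpace ℝ E] [Fintype ι] [DecidableEq ι] [Fintype κ]
    (b : OrthonormalBasis κ ℝ E) (v : Module.Basis ι ℝ E) (B : E →ₗ[ℝ] E →ₗ[ℝ] ℝ) :
    IsUnit (Matrix.of fun i j ↦ inner ℝ (v i) (v j)).det ∧
    ∑ k, B (b k) (b k) =
      ∑ i, ∑ j, (Matrix.of fun i j ↦ inner ℝ (v i) (v j))⁻¹ i j * B (v i) (v j) := by
  classical
  set G : Matrix ι ι ℝ := Matrix.of fun i j ↦ inner ℝ (v i) (v j) with hG
  set Q := v.toMatrix b with hQ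
  set P := b.toBasis.toMatrix v with hP
  have hQP : Q * P = 1 := by
    have := v.toMatrix_mul_toMatrix_flip b.toBasis
    simpa [hQ, hP] using this
  have hPQ : P * Q = 1 := by
    have := b.toBasis.toMatrix_mul_toMatrix_flip v
    simpa [hQ, hP] using this
  have hGP : G = P.transpose * P := by
    ext i j
    simp only [hG, Matrix.of_apply, Matrix.mul_apply, Matrix.transpose_apply, hP,
      Module.Basis.toMatrix_apply, OrthonormalBasis.coe_toBasis_repr_apply,
      OrthonormalBasis.repr_apply_apply]
    rw [← b.sum_inner_mul_inner (v i) (v j)]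
    exact Finset.sum_congr rfl fun k _ ↦ by rw [real_inner_comm]
  -- From `G = PᵀP` and `Q = P⁻¹`, the inverse Gram matrix is `QQᵀ`, whose entries are the
  -- coefficients that appear when each `b k` is expanded in `v`.
  have hinv : G * (Q * Q.transpose) = 1 := by
    rw [hGP, Matrix.mul_assoc, ← Matrix.mul_assoc P, hPQ, Matrix.one_mul, ← Matrix.transpose_mul,
      hQP, Matrix.transpose_one]
  refine ⟨(Matrix.isUnit_iff_isUnit_det _).1 (IsUnit.of_mul_eq_one _ hinv), ?_⟩
  rw [Matrix.inv_eq_right_inv hinv]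
  have hb : ∀ k, b k = ∑ i, Q i k • v i := fun k ↦ (v.sum_toMatrix_smul_self b k).symm
  calc ∑ k, B (b k) (b k) = ∑ k, ∑ i, ∑ j, Q i k * Q j k * B (v i) (v j) := by
        refine Finset.sum_congr rfl fun k _ ↦ ?_
        conv_lhs => rw [hb k]
        simp only [map_sum, map_smul, LinearMap.sum_apply, LinearMap.smul_apply, smul_eq_mul,
          Finset.mul_sum]
        rw [Finset.sum_comm]
        exact Finset.sum_congr rfl fun i _ ↦ Finset.sum_congr rfl fun j _ ↦ by ring
    _ = _ := by
        rw [Finset.sum_comm]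
        refine Finset.sum_congr rfl fun i _ ↦ ?_
        rw [Finset.sum_comm]
        refine Finset.sum_congr rfl fun j _ ↦ ?_
        rw [Matrix.mul_apply, Finset.sum_mul]
        exact Finset.sum_congr rfl fun k _ ↦ by rw [Matrix.transpose_apply]

end Trace

section Continuity

variable {n : ℕ} {M : Type*} [TopologicalSpace M] [ChartedSpace (EuclideanSpace ℝ (Fin n)) M]
  [IsManifold (𝓡 n) ∞ M]
  [RiemannianBundle (fun x : M ↦ TangentSpace (𝓡 n) x)]
  [IsContMDiffRiemannianBundle (𝓡 n) ∞ (EuclideanSpace ℝ (Fin n))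
    (fun x : M ↦ TangentSpace (𝓡 n) x)]

theorem _root_.ContinuousAt.matrix_inv_apply {X ι : Type*} [TopologicalSpace X] [Fintype ι]
    [DecidableEq ι] {G : X → Matrix ι ι ℝ} {x : X} (hG : ContinuousAt G x)
    (hx : (G x).det ≠ 0) (i j : ι) : ContinuousAt (fun y ↦ (G y)⁻¹ i j) x := by
  have h1 : ContinuousAt (fun y ↦ (G y).det) x :=
    (Continuous.matrix_det continuous_id).continuousAt.comp hG
  have h2 : ContinuousAt (fun y ↦ (G y).adjugate i j) x :=
    ((Continuous.matrix_adjugate continuous_id).matrix_elem i j).continuousAt.comp hG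
  simp only [Matrix.inv_def, Matrix.smul_apply, Ring.inverse_eq_inv', smul_eq_mul]
  exact (h1.inv₀ hx).mul h2

/-- If a field of bilinear forms on the tangent spaces is continuous on smooth vector fields, then
so is its metric trace. -/
theorem continuousAt_trace (B : Π x : M, TangentSpace (𝓡 n) x →ₗ[ℝ] TangentSpace (𝓡 n) x →ₗ[ℝ] ℝ)
    (x₀ : M)
    (hB : ∀ X Y : Π x : M, TangentSpace (𝓡 n) x,
      ContMDiffAt (𝓡 n) ((𝓡 n).prod (𝓡 n)) ∞
        (fun x ↦ TotalSpace.mk' (EuclideanSpace ℝ (Fin n)) x (X x)) x₀ →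
      ContMDiffAt (𝓡 n) ((𝓡 n).prod (𝓡 n)) ∞
        (fun x ↦ TotalSpace.mk' (EuclideanSpace ℝ (Fin n)) x (Y x)) x₀ →
      ContinuousAt (fun x ↦ B x (X x) (Y x)) x₀) :
    ContinuousAt (fun x ↦ ∑ k, B x (stdOrthonormalBasis ℝ (TangentSpace (𝓡 n) x) k)
      (stdOrthonormalBasis ℝ (TangentSpace (𝓡 n) x) k)) x₀ := by
  classical
  set e := trivializationAt (EuclideanSpace ℝ (Fin n)) (fun x : M ↦ TangentSpace (𝓡 n) x) x₀
  set b := (EuclideanSpace.basisFun (Fin n) ℝ).toBasis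
  have hfr := e.isLocalFrameOn_localFrame_baseSet (𝓡 n) ∞ b
  have hx₀ : x₀ ∈ e.baseSet := FiberBundle.mem_baseSet_trivializationAt' x₀
  set G : M → Matrix (Fin n) (Fin n) ℝ := fun x ↦
    Matrix.of fun i j ↦ inner ℝ (e.localFrame b i x) (e.localFrame b j x)
  have hsm := fun i ↦ hfr.contMDiffAt e.open_baseSet hx₀ i
  -- `stdOrthonormalBasis` is chosen separately at each point, with no continuity in `x`. The trace
  -- does not depend on the choice, so it can be computed in a smooth local frame.
  have key : ∀ x ∈ e.baseSet, IsUnit (G x).det ∧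
      ∑ k, B x (stdOrthonormalBasis ℝ (TangentSpace (𝓡 n) x) k)
        (stdOrthonormalBasis ℝ (TangentSpace (𝓡 n) x) k) =
      ∑ i, ∑ j, (G x)⁻¹ i j * B x (e.localFrame b i x) (e.localFrame b j x) := by
    intro x hx
    have := sum_orthonormalBasis_eq_gram_inv (stdOrthonormalBasis ℝ (TangentSpace (𝓡 n) x))
      (hfr.toBasisAt hx) (B x)
    simpa only [hfr.toBasisAt_coe] using this
  have hGc : ContinuousAt G x₀ := by
    refine continuousAt_pi.2 fun i ↦ continuousAt_pi.2 fun j ↦ ?_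
    exact (ContMDiffAt.inner_bundle (hsm i) (hsm j)).continuousAt
  have : ContinuousAt (fun x ↦ ∑ i, ∑ j, (G x)⁻¹ i j *
      B x (e.localFrame b i x) (e.localFrame b j x)) x₀ := by
    refine tendsto_finsetSum _ fun i _ ↦ tendsto_finsetSum _ fun j _ ↦ ?_
    exact (hGc.matrix_inv_apply (key x₀ hx₀).1.ne_zero i j).mul (hB _ _ (hsm i) (hsm j))
  refine this.congr ?_
  filter_upwards [e.open_baseSet.mem_nhds hx₀] with x hx using (key x hx).2.symm

end Continuity

/-! ### The Riemannian measure: change of charts, finiteness, positivity on open sets -/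

section ModelInner

variable {n : ℕ} {M : Type*} [TopologicalSpace M] [ChartedSpace (EuclideanSpace ℝ (Fin n)) M]
  [RiemannianBundle (fun x : M ↦ TangentSpace (𝓡 n) x)]

/-- The metric at `x` as a function on the model space. -/
noncomputable def modelInner (x : M) (v w : EuclideanSpace ℝ (Fin n)) : ℝ :=
  @inner ℝ (TangentSpace (𝓡 n) x) _ v w

/-- Gram matrices in two charts involve tangent spaces at base points that are only propositionally
equal. With vectors kept in the model space, the base point can be rewritten freely. -/
theorem modelInner_sum {x : M} {ι : Type*} [Fintype ι] (a b : ι → ℝ)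
    (u : ι → EuclideanSpace ℝ (Fin n)) :
    modelInner x (∑ k, a k • u k) (∑ l, b l • u l) =
      ∑ k, ∑ l, a k * b l * modelInner x (u k) (u l) := by
  let u' : ι → TangentSpace (𝓡 n) x := u
  have := sum_inner (𝕜 := ℝ) Finset.univ (fun k ↦ a k • u' k) (∑ l, b l • u' l)
  refine this.trans (Finset.sum_congr rfl fun k _ ↦ ?_)
  rw [inner_sum]
  refine Finset.sum_congr rfl fun l _ ↦ ?_
  rw [real_inner_smul_left, real_inner_smul_right, mul_assoc]
  rfl

end ModelInner

section ChartVolume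

variable {n : ℕ} {M : Type*} [TopologicalSpace M] [ChartedSpace (EuclideanSpace ℝ (Fin n)) M]
  [MeasurableSpace M] [BorelSpace M]

theorem aemeasurable_extChartAt_symm (x₀ : M) :
    AEMeasurable (extChartAt (𝓡 n) x₀).symm
      ((volume : Measure (EuclideanSpace ℝ (Fin n))).restrict (extChartAt (𝓡 n) x₀).target) :=
  (continuousOn_extChartAt_symm x₀).aemeasurable (isOpen_extChartAt_target x₀).measurableSet

theorem measurableSet_target_inter_preimage (x₀ : M) {A : Set M} (hA : MeasurableSet A) :
    MeasurableSet ((extChartAt (𝓡 n) x₀).target ∩ (extChartAt (𝓡 n) x₀).symm ⁻¹' A) := by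
  have h := (continuousOn_iff_continuous_domRestrict.1
    (continuousOn_extChartAt_symm (I := 𝓡 n) x₀)).measurable hA
  have := (isOpen_extChartAt_target (I := 𝓡 n) x₀).measurableSet.subtype_image h
  convert this using 1
  ext y
  simp [and_comm]

variable [RiemannianBundle (fun x : M ↦ TangentSpace (𝓡 n) x)]

theorem chartVolume_apply (x₀ : M) {A : Set M} (hA : MeasurableSet A) :
    chartVolume (n := n) x₀ A =
      ∫⁻ y in (extChartAt (𝓡 n) x₀).target ∩ (extChartAt (𝓡 n) x₀).symm ⁻¹' A,
        ENNReal.ofReal (Real.sqrt (gramMatrix x₀ y).det) := by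
  rw [chartVolume, Measure.map_apply_of_aemeasurable
    ((aemeasurable_extChartAt_symm x₀).mono_ac (withDensity_absolutelyContinuous _ _)) hA,
    withDensity_apply', Measure.restrict_restrict' (isOpen_extChartAt_target x₀).measurableSet,
    inter_comm]

theorem chartVolume_compl_source (x₀ : M) :
    chartVolume (n := n) x₀ (extChartAt (𝓡 n) x₀).sourceᶜ = 0 := by
  rw [chartVolume_apply x₀ (isOpen_extChartAt_source x₀).measurableSet.compl]
  have : (extChartAt (𝓡 n) x₀).target ∩
      (extChartAt (𝓡 n) x₀).symm ⁻¹' (extChartAt (𝓡 n) x₀).sourceᶜ = ∅ := by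
    ext y
    simp only [mem_inter_iff, mem_preimage, mem_compl_iff, mem_empty_iff_false, iff_false, not_and,
      not_not]
    exact fun hy ↦ (extChartAt (𝓡 n) x₀).map_target hy
  rw [this, Measure.restrict_empty, lintegral_zero_measure]

end ChartVolume

section Volume

variable {n : ℕ} {M : Type*} [TopologicalSpace M] [ChartedSpace (EuclideanSpace ℝ (Fin n)) M]
  [IsManifold (𝓡 n) ∞ M]

theorem mdifferentiableAt_extChartAt_symm_of_mem {x₀ : M} {y : EuclideanSpace ℝ (Fin n)}
    (hy : y ∈ (extChartAt (𝓡 n) x₀).target) :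
    MDifferentiableAt 𝓘(ℝ, EuclideanSpace ℝ (Fin n)) (𝓡 n) (extChartAt (𝓡 n) x₀).symm y :=
  ((contMDiffOn_extChartAt_symm (n := 1) x₀).contMDiffAt
    ((isOpen_extChartAt_target x₀).mem_nhds hy)).mdifferentiableAt one_ne_zero

theorem mfderiv_extChartAt_symm_injective {x₀ : M} {y : EuclideanSpace ℝ (Fin n)}
    (hy : y ∈ (extChartAt (𝓡 n) x₀).target) :
    Function.Injective (mfderiv 𝓘(ℝ, EuclideanSpace ℝ (Fin n)) (𝓡 n)
      (extChartAt (𝓡 n) x₀).symm y) := by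
  have h := mfderiv_extChartAt_comp_mfderivWithin_extChartAt_symm (I := 𝓡 n) hy
  simp only [modelWithCornersSelf_coe, range_id, mfderivWithin_univ] at h
  intro v w hvw
  have hv := congr($h v)
  have hw := congr($h w)
  simp only [ContinuousLinearMap.comp_apply] at hv hw
  rw [hvw] at hv
  exact (hv.symm.trans hw)

/-- The coordinate change between two charts. -/
theorem contDiffAt_chartChange (x₀ x₁ : M) {z : EuclideanSpace ℝ (Fin n)}
    (hz : z ∈ (extChartAt (𝓡 n) x₁).target)
    (hz₀ : (extChartAt (𝓡 n) x₁).symm z ∈ (extChartAt (𝓡 n) x₀).source) :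
    ContDiffAt ℝ 1 (extChartAt (𝓡 n) x₀ ∘ (extChartAt (𝓡 n) x₁).symm) z := by
  rw [← contMDiffAt_iff_contDiffAt]
  exact (contMDiffAt_extChartAt' (by simpa using hz₀)).comp z
    ((contMDiffOn_extChartAt_symm (n := 1) x₁).contMDiffAt
      ((isOpen_extChartAt_target x₁).mem_nhds hz))

variable [RiemannianBundle (fun x : M ↦ TangentSpace (𝓡 n) x)]

/-- By the chain rule the coordinate vectors transform by the Jacobian matrix `A` of the coordinate
change, so the Gram matrices satisfy `G₁ = Aᵀ G₀ A`. -/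
theorem det_gramMatrix_chartChange (x₀ x₁ : M) {z : EuclideanSpace ℝ (Fin n)}
    (hz : z ∈ (extChartAt (𝓡 n) x₁).target)
    (hz₀ : (extChartAt (𝓡 n) x₁).symm z ∈ (extChartAt (𝓡 n) x₀).source) :
    (gramMatrix x₁ z).det =
      (fderiv ℝ (extChartAt (𝓡 n) x₀ ∘ (extChartAt (𝓡 n) x₁).symm) z).det ^ 2 *
        (gramMatrix x₀ ((extChartAt (𝓡 n) x₀ ∘ (extChartAt (𝓡 n) x₁).symm) z)).det := by
  set τ := extChartAt (𝓡 n) x₀ ∘ (extChartAt (𝓡 n) x₁).symm with hτ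
  set b := (EuclideanSpace.basisFun (Fin n) ℝ).toBasis with hb
  set A : Matrix (Fin n) (Fin n) ℝ := LinearMap.toMatrix b b (fderiv ℝ τ z : _ →ₗ[ℝ] _) with hA
  have hpt : (extChartAt (𝓡 n) x₀).symm (τ z) = (extChartAt (𝓡 n) x₁).symm z :=
    (extChartAt (𝓡 n) x₀).left_inv hz₀
  have hτz : τ z ∈ (extChartAt (𝓡 n) x₀).target := (extChartAt (𝓡 n) x₀).map_source hz₀
  have hder : HasFDerivAt τ (fderiv ℝ τ z) z :=
    ((contDiffAt_chartChange x₀ x₁ hz hz₀).differentiableAt one_ne_zero).hasFDerivAt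
  have hcomp := (mdifferentiableAt_extChartAt_symm_of_mem hτz).hasMFDerivAt.comp z
    hder.hasMFDerivAt
  -- The factorisation through `τ` holds only where the two chart domains overlap; a neighbourhood
  -- of `z` is enough for comparing derivatives.
  have hev : (extChartAt (𝓡 n) x₁).symm =ᶠ[𝓝 z] (extChartAt (𝓡 n) x₀).symm ∘ τ := by
    have h1 : ContinuousAt (extChartAt (𝓡 n) x₁).symm z :=
      (mdifferentiableAt_extChartAt_symm_of_mem hz).continuousAt
    filter_upwards [h1.preimage_mem_nhds ((isOpen_extChartAt_source x₀).mem_nhds hz₀)] with y hy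
    exact ((extChartAt (𝓡 n) x₀).left_inv hy).symm
  have hD := (hcomp.congr_of_eventuallyEq hev).mfderiv
  let u : Fin n → EuclideanSpace ℝ (Fin n) := fun i ↦ coordVector x₀ (τ z) i
  let w : Fin n → EuclideanSpace ℝ (Fin n) := fun i ↦ coordVector x₁ z i
  have hw : ∀ j, w j = ∑ i, A i j • u i := by
    intro j
    let D : EuclideanSpace ℝ (Fin n) →L[ℝ] EuclideanSpace ℝ (Fin n) :=
      mfderiv 𝓘(ℝ, EuclideanSpace ℝ (Fin n)) (𝓡 n) (extChartAt (𝓡 n) x₀).symm (τ z)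
    have h1 : w j = D (fderiv ℝ τ z (EuclideanSpace.single j (1 : ℝ))) :=
      congr($hD (EuclideanSpace.single j (1 : ℝ)))
    have h2 : fderiv ℝ τ z (EuclideanSpace.single j (1 : ℝ)) =
        ∑ i, A i j • EuclideanSpace.single i (1 : ℝ) := by
      have := (b.sum_repr (fderiv ℝ τ z (EuclideanSpace.single j (1 : ℝ)))).symm
      simpa [hA, hb, LinearMap.toMatrix_apply] using this
    rw [h1, h2, map_sum]
    exact Finset.sum_congr rfl fun i _ ↦ map_smul D _ _
  have hG : gramMatrix x₁ z = A.transpose * gramMatrix x₀ (τ z) * A := by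
    ext i j
    have h1 : gramMatrix x₁ z i j = modelInner ((extChartAt (𝓡 n) x₁).symm z) (w i) (w j) := rfl
    have h2 : ∀ k l, gramMatrix x₀ (τ z) k l =
      modelInner ((extChartAt (𝓡 n) x₀).symm (τ z)) (u k) (u l) := fun _ _ ↦ rfl
    rw [h1, hw i, hw j, modelInner_sum, Matrix.mul_assoc]
    simp only [Matrix.mul_apply, Matrix.transpose_apply, h2, hpt, Finset.mul_sum]
    exact Finset.sum_congr rfl fun k _ ↦ Finset.sum_congr rfl fun l _ ↦ by ring
  have hdet : A.det = (fderiv ℝ τ z).det := LinearMap.det_toMatrix b _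
  rw [hG, Matrix.det_mul, Matrix.det_mul, Matrix.det_transpose, hdet]
  ring

theorem det_gramMatrix_pos {x₀ : M} {y : EuclideanSpace ℝ (Fin n)}
    (hy : y ∈ (extChartAt (𝓡 n) x₀).target) : 0 < (gramMatrix x₀ y).det := by
  have hli : LinearIndependent ℝ (coordVector x₀ y) := by
    have h0 := (EuclideanSpace.basisFun (Fin n) ℝ).toBasis.linearIndependent
    let D : EuclideanSpace ℝ (Fin n) →L[ℝ] EuclideanSpace ℝ (Fin n) :=
      mfderiv 𝓘(ℝ, EuclideanSpace ℝ (Fin n)) (𝓡 n) (extChartAt (𝓡 n) x₀).symm y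
    have hD : Function.Injective D := mfderiv_extChartAt_symm_injective hy
    have h1 := h0.map' (D : EuclideanSpace ℝ (Fin n) →ₗ[ℝ] EuclideanSpace ℝ (Fin n))
      (LinearMap.ker_eq_bot.2 hD)
    have h2 : coordVector x₀ y = D ∘ (EuclideanSpace.basisFun (Fin n) ℝ).toBasis := by
      ext1 i
      rw [Function.comp_apply, OrthonormalBasis.coe_toBasis, EuclideanSpace.basisFun_apply]
      rfl
    rw [h2]
    exact h1
  exact (Matrix.posDef_gram_of_linearIndependent (𝕜 := ℝ) hli).det_pos

/-- The Riemannian measures of two charts agree on the intersection of the chart domains. -/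
theorem chartVolume_eq_of_subset [MeasurableSpace M] [BorelSpace M] (x₀ x₁ : M)
    {A : Set M} (hA : MeasurableSet A)
    (h₀ : A ⊆ (extChartAt (𝓡 n) x₀).source) (h₁ : A ⊆ (extChartAt (𝓡 n) x₁).source) :
    chartVolume (n := n) x₀ A = chartVolume (n := n) x₁ A := by
  set τ := extChartAt (𝓡 n) x₀ ∘ (extChartAt (𝓡 n) x₁).symm with hτ
  set S := (extChartAt (𝓡 n) x₁).target ∩ (extChartAt (𝓡 n) x₁).symm ⁻¹' A with hS
  have himg : (extChartAt (𝓡 n) x₀).target ∩ (extChartAt (𝓡 n) x₀).symm ⁻¹' A = τ '' S := by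
    ext y
    constructor
    · rintro ⟨hy, hyA⟩
      refine ⟨extChartAt (𝓡 n) x₁ ((extChartAt (𝓡 n) x₀).symm y),
        ⟨(extChartAt (𝓡 n) x₁).map_source (h₁ hyA), ?_⟩, ?_⟩
      · rw [mem_preimage, (extChartAt (𝓡 n) x₁).left_inv (h₁ hyA)]
        exact hyA
      · rw [hτ, Function.comp_apply, (extChartAt (𝓡 n) x₁).left_inv (h₁ hyA),
          (extChartAt (𝓡 n) x₀).right_inv hy]
    · rintro ⟨z, ⟨_, hzA⟩, rfl⟩
      refine ⟨(extChartAt (𝓡 n) x₀).map_source (h₀ hzA), ?_⟩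
      rw [mem_preimage, hτ, Function.comp_apply, (extChartAt (𝓡 n) x₀).left_inv (h₀ hzA)]
      exact hzA
  have hinj : InjOn τ S :=
    (extChartAt (𝓡 n) x₀).injOn.comp ((extChartAt (𝓡 n) x₁).symm.injOn.mono inter_subset_left)
      fun z hz ↦ h₀ hz.2
  have hder : ∀ z ∈ S, HasFDerivWithinAt τ (fderiv ℝ τ z) S z := fun z hz ↦
    ((contDiffAt_chartChange x₀ x₁ hz.1 (h₀ hz.2)).differentiableAt
      one_ne_zero).hasFDerivAt.hasFDerivWithinAt
  have hSm : MeasurableSet S := measurableSet_target_inter_preimage x₁ hA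
  rw [chartVolume_apply x₀ hA, chartVolume_apply x₁ hA, himg,
    lintegral_image_eq_lintegral_abs_det_fderiv_mul _ hSm hder hinj]
  refine setLIntegral_congr_fun hSm fun z hz ↦ ?_
  rw [det_gramMatrix_chartChange x₀ x₁ hz.1 (h₀ hz.2), Real.sqrt_mul (sq_nonneg _),
    Real.sqrt_sq_eq_abs, ENNReal.ofReal_mul (abs_nonneg _)]

variable [IsContMDiffRiemannianBundle (𝓡 n) ∞ (EuclideanSpace ℝ (Fin n))
    (fun x : M ↦ TangentSpace (𝓡 n) x)]

variable (n M) in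
theorem isContinuousRiemannianBundle_tangentSpace :
    IsContinuousRiemannianBundle (EuclideanSpace ℝ (Fin n))
      (fun x : M ↦ TangentSpace (𝓡 n) x) := by
  obtain ⟨g, hg, h⟩ := IsContMDiffRiemannianBundle.exists_contMDiff (IB := 𝓡 n) (n := ∞)
    (F := EuclideanSpace ℝ (Fin n)) (E := fun x : M ↦ TangentSpace (𝓡 n) x)
  exact ⟨g, hg.continuous, h⟩

/-- The coordinate fields are images of constant fields under the tangent map of the inverse chart,
which is continuous. -/
theorem continuousOn_det_gramMatrix (x₀ : M) :
    ContinuousOn (fun y ↦ (gramMatrix x₀ y).det) (extChartAt (𝓡 n) x₀).target := by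
  have := isContinuousRiemannianBundle_tangentSpace n M
  have hT := (contMDiffOn_extChartAt_symm (I := 𝓡 n) (n := 1) x₀).continuousOn_tangentMapWithin
    le_rfl (isOpen_extChartAt_target x₀).uniqueMDiffOn
  have hv : ∀ i, ContinuousOn (fun y ↦ TotalSpace.mk' (EuclideanSpace ℝ (Fin n))
      (E := fun x : M ↦ TangentSpace (𝓡 n) x) _
      (coordVector x₀ y i)) (extChartAt (𝓡 n) x₀).target := by
    intro i
    have hc : Continuous fun y : EuclideanSpace ℝ (Fin n) ↦
        (TotalSpace.mk' (EuclideanSpace ℝ (Fin n)) y (EuclideanSpace.single i (1 : ℝ)) :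
          TangentBundle 𝓘(ℝ, EuclideanSpace ℝ (Fin n)) (EuclideanSpace ℝ (Fin n))) := by
      exact (tangentBundleModelSpaceHomeomorph 𝓘(ℝ, EuclideanSpace ℝ (Fin n))).symm.continuous.comp
        (Continuous.prodMk continuous_id continuous_const)
    refine (hT.comp hc.continuousOn fun y hy ↦ hy).congr fun y hy ↦ ?_
    simp only [Function.comp, tangentMapWithin]
    rw [mfderivWithin_of_isOpen (isOpen_extChartAt_target x₀) hy]
    rfl
  have hG : ContinuousOn (gramMatrix x₀) (extChartAt (𝓡 n) x₀).target :=
    continuousOn_pi.2 fun i ↦ continuousOn_pi.2 fun j ↦ (hv i).inner_bundle (hv j)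
  exact (Continuous.matrix_det continuous_id).comp_continuousOn hG

variable [MeasurableSpace M] [BorelSpace M]

/-- Over a small coordinate ball the density is bounded by continuity, and the ball has finite
Lebesgue measure. -/
theorem exists_isOpen_chartVolume_lt_top (x₀ : M) :
    ∃ W : Set M, IsOpen W ∧ x₀ ∈ W ∧ W ⊆ (extChartAt (𝓡 n) x₀).source ∧
      chartVolume (n := n) x₀ W < ⊤ := by
  set φ := extChartAt (𝓡 n) x₀ with hφ
  have hy₀ : φ x₀ ∈ φ.target := mem_extChartAt_target x₀
  have hc : ContinuousAt (fun y ↦ (gramMatrix x₀ y).det) (φ x₀) :=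
    (continuousOn_det_gramMatrix x₀).continuousAt ((isOpen_extChartAt_target x₀).mem_nhds hy₀)
  have hev : ∀ᶠ y in 𝓝 (φ x₀), (gramMatrix x₀ y).det < (gramMatrix x₀ (φ x₀)).det + 1 :=
    hc.eventually_lt continuousAt_const (lt_add_one _)
  obtain ⟨r, hr, hball⟩ := Metric.eventually_nhds_iff_ball.1 hev
  set C := Real.sqrt ((gramMatrix x₀ (φ x₀)).det + 1)
  refine ⟨φ.source ∩ φ ⁻¹' Metric.ball (φ x₀) r, isOpen_extChartAt_preimage' x₀ Metric.isOpen_ball,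
    ⟨mem_extChartAt_source x₀, Metric.mem_ball_self hr⟩, inter_subset_left, ?_⟩
  rw [chartVolume_apply x₀ (isOpen_extChartAt_preimage' x₀ Metric.isOpen_ball).measurableSet]
  calc _ ≤ ∫⁻ y in Metric.ball (φ x₀) r, ENNReal.ofReal (Real.sqrt (gramMatrix x₀ y).det) := by
        refine lintegral_mono_set ?_
        rintro y ⟨hy, _, hy'⟩
        rwa [mem_preimage, φ.right_inv hy] at hy'
    _ ≤ ∫⁻ _ in Metric.ball (φ x₀) r, ENNReal.ofReal C :=
        setLIntegral_mono' Metric.isOpen_ball.measurableSet fun y hy ↦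
          ENNReal.ofReal_le_ofReal (Real.sqrt_le_sqrt (hball y hy).le)
    _ < ⊤ := by
        rw [setLIntegral_const]
        exact ENNReal.mul_lt_top ENNReal.ofReal_lt_top measure_ball_lt_top

theorem chartVolume_pos_of_isOpen {U : Set M} (hU : IsOpen U) {x₀ : M} (hx₀ : x₀ ∈ U) :
    chartVolume (n := n) x₀ U ≠ 0 := by
  rw [chartVolume_apply x₀ hU.measurableSet]
  set S := (extChartAt (𝓡 n) x₀).target ∩ (extChartAt (𝓡 n) x₀).symm ⁻¹' U
  have hS : IsOpen S :=
    (continuousOn_extChartAt_symm x₀).isOpen_inter_preimage (isOpen_extChartAt_target x₀) hU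
  have hne : S.Nonempty := ⟨extChartAt (𝓡 n) x₀ x₀, mem_extChartAt_target x₀, by
    simpa [mem_preimage] using hx₀⟩
  have hcont : ContinuousOn (fun y ↦ ENNReal.ofReal (Real.sqrt (gramMatrix x₀ y).det)) S :=
    ENNReal.continuous_ofReal.comp_continuousOn (Real.continuous_sqrt.comp_continuousOn
      ((continuousOn_det_gramMatrix x₀).mono inter_subset_left))
  intro h0
  rw [lintegral_eq_zero_iff' (hcont.aemeasurable hS.measurableSet)] at h0
  have : ∀ᵐ y ∂(volume.restrict S), False := by
    filter_upwards [h0, ae_restrict_mem hS.measurableSet] with y hy hyS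
    have := Real.sqrt_pos.2 (det_gramMatrix_pos hyS.1)
    simp only [Pi.zero_apply, ENNReal.ofReal_eq_zero] at hy
    linarith
  rw [ae_iff] at this
  simp only [not_false_eq_true, ofPred_true, Measure.restrict_apply_univ] at this
  exact (hS.measure_pos volume hne).ne' this

variable (n M) in
theorem isOpenPosMeasure_riemannianVolume : (riemannianVolume n M).IsOpenPosMeasure where
  open_pos U hU := by
    rintro ⟨x₀, hx₀⟩ h0
    exact chartVolume_pos_of_isOpen hU hx₀
      (le_antisymm (h0 ▸ le_iSup (chartVolume (n := n) (M := M)) x₀ U) zero_le)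

-- The supremum may range over infinitely many charts, so finiteness of each chart measure is not
-- enough. Since chart measures agree on overlaps, the supremum is dominated by a finite sum of
-- restrictions to the sets `W x` of a finite subcover.
variable (n M) in
theorem isFiniteMeasure_riemannianVolume [CompactSpace M] :
    IsFiniteMeasure (riemannianVolume n M) := by
  choose W hWo hxW hWs hWfin using exists_isOpen_chartVolume_lt_top (n := n) (M := M)
  obtain ⟨t, ht⟩ := isCompact_univ.elim_finite_subcover W hWo
    fun x _ ↦ mem_iUnion.2 ⟨x, hxW x⟩
  set ν : Measure M := ∑ x ∈ t, (chartVolume (n := n) x).restrict (W x) with hν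
  have hle : riemannianVolume n M ≤ ν := by
    refine iSup_le fun x₀ ↦ Measure.le_iff.2 fun A hA ↦ ?_
    set O := (extChartAt (𝓡 n) x₀).source
    have hO : MeasurableSet O := (isOpen_extChartAt_source x₀).measurableSet
    -- Comparison with another chart needs sets inside both domains. The remainder `Oᶜ` is null for
    -- the measure of the chart at `x₀`.
    calc chartVolume (n := n) x₀ A ≤ chartVolume (n := n) x₀ (⋃ x ∈ t, A ∩ W x ∩ O ∪ Oᶜ) := by
          refine measure_mono fun y hy ↦ ?_
          obtain ⟨x, hx, hyx⟩ := mem_iUnion₂.1 (ht (mem_univ y))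
          refine mem_iUnion₂.2 ⟨x, hx, ?_⟩
          by_cases hyO : y ∈ O
          · exact Or.inl ⟨⟨hy, hyx⟩, hyO⟩
          · exact Or.inr hyO
      _ ≤ ∑ x ∈ t, chartVolume (n := n) x₀ (A ∩ W x ∩ O ∪ Oᶜ) := measure_biUnion_finset_le _ _
      _ ≤ ∑ x ∈ t, chartVolume (n := n) x (A ∩ W x) := by
          refine Finset.sum_le_sum fun x _ ↦ ?_
          refine (measure_union_le _ _).trans ?_
          rw [chartVolume_compl_source, add_zero, chartVolume_eq_of_subset x₀ x
            ((hA.inter (hWo x).measurableSet).inter hO) inter_subset_right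
            fun y hy ↦ hWs x hy.1.2]
          exact measure_mono inter_subset_left
      _ = ν A := by
          rw [hν, Measure.finsetSum_apply]
          exact Finset.sum_congr rfl fun x _ ↦ (Measure.restrict_apply hA).symm
  refine ⟨(hle univ).trans_lt ?_⟩
  rw [hν, Measure.finsetSum_apply]
  refine ENNReal.sum_lt_top.2 fun x _ ↦ ?_
  rw [Measure.restrict_apply_univ]
  exact hWfin x

end Volume

/-! ### Integration over a compact space -/

section Integral

/-- Differentiation under the integral sign over a compact space. -/
theorem hasDerivAt_integral_of_contDiff {X Y : Type*} [TopologicalSpace X] [CompactSpace X]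
    [MeasurableSpace X] [OpensMeasurableSpace X] (μ : Measure X) [IsFiniteMeasure μ]
    [NormedAddCommGroup Y] [NormedSpace ℝ Y] {Φ : ℝ × Y → ℝ} (hΦ : ContDiff ℝ 1 Φ)
    {y : X → Y} (hy : Continuous y) :
    HasDerivAt (fun t ↦ ∫ x, Φ (t, y x) ∂μ) (∫ x, deriv (fun t ↦ Φ (t, y x)) 0 ∂μ) 0 := by
  have hd : ∀ t x, HasDerivAt (fun t ↦ Φ (t, y x)) (fderiv ℝ Φ (t, y x) (1, 0)) t := fun t x ↦
    (hΦ.differentiable one_ne_zero (t, y x)).hasFDerivAt.comp_hasDerivAt t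
      ((hasDerivAt_id t).prodMk (hasDerivAt_const t (y x)))
  have hc' : Continuous fun z : ℝ × X ↦ fderiv ℝ Φ (z.1, y z.2) (1, 0) :=
    ((hΦ.continuous_fderiv one_ne_zero).comp
      (continuous_fst.prodMk (hy.comp continuous_snd))).clm_apply continuous_const
  have hc : ∀ t, Continuous fun x ↦ Φ (t, y x) := fun t ↦
    hΦ.continuous.comp (continuous_const.prodMk hy)
  -- Compactness of `[-1, 1] × X` gives a constant dominating function.
  obtain ⟨C, hC⟩ := ((isCompact_Icc (a := (-1 : ℝ)) (b := 1)).prod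
    (isCompact_univ (X := X))).exists_bound_of_continuousOn hc'.continuousOn
  have hcd : ∀ t, Continuous fun x ↦ fderiv ℝ Φ (t, y x) (1, 0) := fun t ↦
    hc'.comp (continuous_const.prodMk continuous_id)
  have hint : ∀ {g : X → ℝ}, Continuous g → Integrable g μ := fun {g} hg ↦ by
    obtain ⟨C, hC⟩ := isCompact_univ.exists_bound_of_continuousOn hg.continuousOn
    exact Integrable.of_bound hg.aestronglyMeasurable C (.of_forall fun x ↦ hC x (mem_univ x))
  have := (hasDerivAt_integral_of_dominated_loc_of_deriv_le (μ := μ) (𝕜 := ℝ) (x₀ := 0)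
    (F := fun t x ↦ Φ (t, y x)) (F' := fun t x ↦ fderiv ℝ Φ (t, y x) (1, 0))
    (s := Icc (-1) 1) (bound := fun _ ↦ C)
    (Icc_mem_nhds (by norm_num) (by norm_num))
    (.of_forall fun t ↦ (hc t).aestronglyMeasurable) (hint (hc 0))
    (hcd 0).aestronglyMeasurable
    (.of_forall fun x t ht ↦ hC (t, x) ⟨ht, mem_univ x⟩) (integrable_const C)
    (.of_forall fun x t _ ↦ hd t x)).2
  simpa only [(hd 0 _).deriv] using this

theorem eq_zero_of_integral_eq_zero {X : Type*} [TopologicalSpace X] [CompactSpace X]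
    [MeasurableSpace X] [OpensMeasurableSpace X] (μ : Measure X) [IsFiniteMeasure μ]
    [μ.IsOpenPosMeasure] {g : X → ℝ} (hg : Continuous g) (hg0 : ∀ x, 0 ≤ g x)
    (h : ∫ x, g x ∂μ = 0) (x : X) : g x = 0 := by
  obtain ⟨C, hC⟩ := isCompact_univ.exists_bound_of_continuousOn hg.continuousOn
  have hint : Integrable g μ :=
    Integrable.of_bound hg.aestronglyMeasurable C (.of_forall fun x ↦ hC x (mem_univ x))
  have := (integral_eq_zero_iff_of_nonneg hg0 hint).1 h
  exact congr_fun ((Continuous.ae_eq_iff_eq μ hg continuous_zero).1 this) x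

end Integral

/-! ### First variation along the weighted radial direction, and the sign of its coefficients -/

section RadialVariation

/-- The density of the energy of `(1 + t exp(K|σ|²)) σ`, as a function of `t`, `|σ|`, `|∇σ|²` and
`∑ᵢ ⟨∇ᵢσ, σ⟩²`. -/
noncomputable def radialDensity (p q K : ℝ) (z : ℝ × ℝ × ℝ × ℝ) : ℝ :=
  (1 / (1 + ((1 + z.1 * Real.exp (K * z.2.1 ^ 2)) * z.2.1) ^ 2)) ^ p *
    ((1 + z.1 * Real.exp (K * z.2.1 ^ 2)) ^ 2 * z.2.2.1 +
      (2 * (1 + z.1 * Real.exp (K * z.2.1 ^ 2)) * (2 * K * z.1 * Real.exp (K * z.2.1 ^ 2)) +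
        (2 * K * z.1 * Real.exp (K * z.2.1 ^ 2)) ^ 2 * z.2.1 ^ 2 +
        q * ((1 + z.1 * Real.exp (K * z.2.1 ^ 2)) * ((1 + z.1 * Real.exp (K * z.2.1 ^ 2)) +
          (2 * K * z.1 * Real.exp (K * z.2.1 ^ 2)) * z.2.1 ^ 2)) ^ 2) * z.2.2.2)

theorem contDiff_radialDensity (p q K : ℝ) : ContDiff ℝ 1 (radialDensity p q K) := by
  unfold radialDensity
  refine ContDiff.mul (ContDiff.rpow_const_of_ne ?_ fun z ↦ by positivity) (by fun_prop)
  exact contDiff_const.div (by fun_prop) fun z ↦ by positivity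

/-- The first variation of the energy density along `(1 + t exp(K|σ|²)) σ`. -/
theorem deriv_radialDensity (p q K r b c : ℝ) :
    deriv (fun t ↦ radialDensity p q K (t, r, b, c)) 0 =
      2 * Real.exp (K * r ^ 2) * ((1 / (1 + r ^ 2)) ^ (p + 1) *
        ((1 + (1 - p) * r ^ 2) * b +
          (2 * K * (1 + r ^ 2) * (1 + q * r ^ 2) + q * (2 + (2 - p) * r ^ 2)) * c)) := by
  set f := Real.exp (K * r ^ 2) with hf
  have hu : HasDerivAt (fun t : ℝ ↦ 1 + t * f) f 0 := by
    simpa using ((hasDerivAt_id (0 : ℝ)).mul_const f).const_add 1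
  have hd : HasDerivAt (fun t : ℝ ↦ 2 * K * t * f) (2 * K * f) 0 := by
    simpa using (((hasDerivAt_id (0 : ℝ)).const_mul (2 * K)).mul_const f)
  have hpos : (0 : ℝ) < 1 + r ^ 2 := by positivity
  have hW := ((((hu.mul_const r).pow 2).const_add 1).fun_inv (by simp; positivity)).rpow_const
    (p := p) (Or.inl (by simp; positivity))
  have hB := ((hu.pow 2).mul_const b).fun_add
    (((((hu.const_mul 2).mul hd).add ((hd.pow 2).mul_const (r ^ 2))).add
      (((hu.mul (hu.add (hd.mul_const (r ^ 2)))).pow 2).const_mul q)).mul_const c)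
  have h := hW.mul hB
  have h' := h.congr_of_eventuallyEq (f₁ := fun t ↦ radialDensity p q K (t, r, b, c))
    (.of_forall fun t ↦ by
      simp only [radialDensity, ← hf, one_div, Pi.mul_apply, Pi.add_apply, Pi.pow_apply])
  rw [h'.deriv]
  -- With all real powers expressed through the `p`-th power, the claim becomes an identity of
  -- rational functions.
  have hp1 : (1 / (1 + r ^ 2)) ^ (p + 1) = (1 / (1 + r ^ 2)) ^ p * (1 / (1 + r ^ 2)) :=
    Real.rpow_add_one (by positivity) p
  have hp2 : (1 / (1 + r ^ 2)) ^ (p - 1) = (1 / (1 + r ^ 2)) ^ p * (1 + r ^ 2) := by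
    rw [Real.rpow_sub_one (by positivity)]
    field_simp
  simp only [Pi.mul_apply, Pi.add_apply, Pi.pow_apply, zero_mul, mul_zero, add_zero, one_mul,
    ← one_div, hp1, hp2, Nat.cast_ofNat, pow_one, Nat.add_one_sub_one]
  generalize (1 / (1 + r ^ 2)) ^ p = W
  field_simp
  ring

/-- Here `a` is `|σ|²`, and the last expression is the coefficient of `∑ᵢ⟨∇ᵢσ, σ⟩²` for `K = 2|q|`.
Dividing the hypothesis by `ν` gives `(1-p)a ≥ -1/ν`, whence the first two claims. If `q ≥ 0`, then
`2 + (2-p)a = (1 + (1-p)a) + (1 + a)` is nonnegative. If `q < 0`, the cut-off forces `p > 2`, and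
then `1 + qa ≥ 1 + ν(1-p)a/2 + νa/2 ≥ 1/2`; the factor 2 in `K` matches this bound. -/
theorem cutoff_estimates {p q ν a : ℝ} (ha : 0 ≤ a) (hν : 1 ≤ ν) (hq : cutoff ν p ≤ q)
    (h : -1 ≤ ν * (1 - p) * a) :
    0 ≤ 1 + (1 - p) * a ∧ (1 < ν → 0 < 1 + (1 - p) * a) ∧
      0 ≤ 2 * (2 * |q|) * (1 + a) * (1 + q * a) + q * (2 + (2 - p) * a) := by
  have h1 : 0 ≤ 1 + (1 - p) * a := by
    rcases le_or_gt 0 ((1 - p) * a) with h0 | h0 <;> nlinarith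
  have h2 : 1 < ν → 0 < 1 + (1 - p) * a := fun hν' ↦ by
    rcases le_or_gt 0 ((1 - p) * a) with h0 | h0 <;> nlinarith
  refine ⟨h1, h2, ?_⟩
  rcases le_or_gt 0 q with hq0 | hq0
  · have h3 : 0 ≤ 2 + (2 - p) * a := by nlinarith
    have := mul_nonneg hq0 h3
    positivity
  · have hp : 2 < p ∧ ν * (2 - p) / 2 ≤ q := by
      unfold cutoff at hq
      split_ifs at hq with h3 h4
      · linarith
      · linarith
      · exact ⟨not_le.1 h4, hq⟩
    have h3 : ν * (2 - p) / 2 * a ≤ q * a := mul_le_mul_of_nonneg_right hp.2 ha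
    have h4 : 0 ≤ ν * a := by positivity
    have h5 : 1 / 2 ≤ 1 + q * a := by nlinarith
    rw [abs_of_neg hq0]
    -- The target is exactly four times this quantity plus the one in `h7`.
    have h6 : 0 ≤ -q * (1 + a) * (1 + q * a - 1 / 2) :=
      mul_nonneg (mul_nonneg (by linarith) (by linarith)) (by linarith)
    have h7 : 0 ≤ -q * (p * a) := mul_nonneg (by linarith) (mul_nonneg (by linarith) ha)
    nlinarith

end RadialVariation

/-! ### Covariant derivatives of a section and of its radial variation -/

section Sections

variable {n : ℕ} {M : Type*} [TopologicalSpace M] [ChartedSpace (EuclideanSpace ℝ (Fin n)) M]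
  {F : Type*} [NormedAddCommGroup F] [NormedSpace ℝ F]
  {V : M → Type*} [TopologicalSpace (TotalSpace F V)]
  [∀ x, NormedAddCommGroup (V x)] [∀ x, InnerProductSpace ℝ (V x)]
  [FiberBundle F V] 

section

variable (cov : CovariantDerivative (𝓡 n) F V)
  [RiemannianBundle (fun x : M ↦ TangentSpace (𝓡 n) x)]

/-- `|∇σ|²`. -/
noncomputable def covNormSq (σ : Π x : M, V x) (x : M) : ℝ :=
  ∑ i, ‖cov σ x (stdOrthonormalBasis ℝ (TangentSpace (𝓡 n) x) i)‖ ^ 2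

/-- `∑ᵢ ⟨∇ᵢσ, σ⟩²`. -/
noncomputable def covRadialSq (σ : Π x : M, V x) (x : M) : ℝ :=
  ∑ i, inner ℝ (cov σ x (stdOrthonormalBasis ℝ (TangentSpace (𝓡 n) x) i)) (σ x) ^ 2

theorem covNormSq_nonneg (σ : Π x : M, V x) (x : M) : 0 ≤ covNormSq cov σ x :=
  Finset.sum_nonneg fun _ _ ↦ sq_nonneg _

theorem covRadialSq_nonneg (σ : Π x : M, V x) (x : M) : 0 ≤ covRadialSq cov σ x :=
  Finset.sum_nonneg fun _ _ ↦ sq_nonneg _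

theorem cov_eq_zero_of_covNormSq_eq_zero {σ : Π x : M, V x} {x : M} (h : covNormSq cov σ x = 0) :
    cov σ x = 0 := by
  have h1 := (Finset.sum_eq_zero_iff_of_nonneg fun _ _ ↦ sq_nonneg _).1 h
  refine ContinuousLinearMap.coe_injective
    ((stdOrthonormalBasis ℝ (TangentSpace (𝓡 n) x)).toBasis.ext fun i ↦ ?_)
  have h2 := h1 i (Finset.mem_univ i)
  simpa using h2

theorem norm_cov_sq_le_covNormSq (σ : Π x : M, V x) (x : M)
    (i : Fin (Module.finrank ℝ (TangentSpace (𝓡 n) x))) :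
    ‖cov σ x (stdOrthonormalBasis ℝ (TangentSpace (𝓡 n) x) i)‖ ^ 2 ≤ covNormSq cov σ x :=
  Finset.single_le_sum
    (f := fun i ↦ ‖cov σ x (stdOrthonormalBasis ℝ (TangentSpace (𝓡 n) x) i)‖ ^ 2)
    (fun _ _ ↦ sq_nonneg _) (Finset.mem_univ i)

end

variable [VectorBundle ℝ F V]

theorem isSmoothVariation_radial [ContMDiffVectorBundle ∞ F V (𝓡 n)] {σ : Π x : M, V x}
    (hσ : ContMDiff (𝓡 n) ((𝓡 n).prod 𝓘(ℝ, F)) ∞ (fun x ↦ TotalSpace.mk' F x (σ x)))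
    {f : M → ℝ} (hf : ContMDiff (𝓡 n) 𝓘(ℝ, ℝ) ∞ f) :
    IsSmoothVariation F n σ (fun t x ↦ (1 + t * f x) • σ x) := by
  refine ⟨by simp, fun z₀ ↦ contMDiffAt_totalSpace.2 ⟨contMDiffAt_fst, ?_⟩⟩
  set e := trivializationAt F V z₀.1
  have h1 : ContMDiffAt ((𝓡 n).prod 𝓘(ℝ, ℝ)) 𝓘(ℝ, F) ∞
      (fun z : M × ℝ ↦ (e ⟨z.1, σ z.1⟩).2) z₀ :=
    ((contMDiffAt_section z₀.1).1 (hσ z₀.1)).comp z₀ contMDiffAt_fst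
  have h2 : ContMDiffAt ((𝓡 n).prod 𝓘(ℝ, ℝ)) 𝓘(ℝ, ℝ) ∞
      (fun z : M × ℝ ↦ 1 + z.2 * f z.1) z₀ :=
    contMDiffAt_const.add (contMDiffAt_snd.mul ((hf z₀.1).comp z₀ contMDiffAt_fst))
  refine (h2.smul h1).congr_of_eventuallyEq ?_
  have hb : ∀ᶠ z : M × ℝ in 𝓝 z₀, z.1 ∈ e.baseSet :=
    continuous_fst.continuousAt.preimage_mem_nhds
      (e.open_baseSet.mem_nhds (FiberBundle.mem_baseSet_trivializationAt' z₀.1))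
  filter_upwards [hb] with z hz
  exact (e.linear ℝ hz).map_smul _ _

theorem contMDiffAt_cov_apply [IsManifold (𝓡 n) ∞ M]
    (cov : CovariantDerivative (𝓡 n) F V) [ContMDiffVectorBundle ∞ F V (𝓡 n)]
    [CovariantDerivative.ContMDiffCovariantDerivative cov ∞] {σ : Π x : M, V x}
    (hσ : ContMDiff (𝓡 n) ((𝓡 n).prod 𝓘(ℝ, F)) ∞ (fun x ↦ TotalSpace.mk' F x (σ x)))
    {X : Π x : M, TangentSpace (𝓡 n) x} {x₀ : M}
    (hX : ContMDiffAt (𝓡 n) ((𝓡 n).prod (𝓡 n)) ∞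
        (fun x ↦ TotalSpace.mk' (EuclideanSpace ℝ (Fin n)) x (X x)) x₀) :
    ContMDiffAt (𝓡 n) ((𝓡 n).prod 𝓘(ℝ, F)) ∞
      (fun x ↦ TotalSpace.mk' F x (cov σ x (X x))) x₀ := by
  have h := (CovariantDerivative.ContMDiffCovariantDerivative.contMDiff (cov := cov)
    (k := ∞)).contMDiff (σ := σ) hσ.contMDiffOn
  exact (h.contMDiffAt univ_mem).clm_bundle_apply hX

theorem contMDiff_norm_sq [IsContMDiffRiemannianBundle (𝓡 n) ∞ F V] {σ : Π x : M, V x}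
    (hσ : ContMDiff (𝓡 n) ((𝓡 n).prod 𝓘(ℝ, F)) ∞ (fun x ↦ TotalSpace.mk' F x (σ x))) :
    ContMDiff (𝓡 n) 𝓘(ℝ, ℝ) ∞ fun x ↦ ‖σ x‖ ^ 2 := by
  simpa only [real_inner_self_eq_norm_sq] using ContMDiff.inner_bundle hσ hσ

section

variable [IsManifold (𝓡 n) ∞ M] [ContMDiffVectorBundle ∞ F V (𝓡 n)]
  [IsContMDiffRiemannianBundle (𝓡 n) ∞ F V]
  (cov : CovariantDerivative (𝓡 n) F V) {σ : Π x : M, V x}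
  (hσ : ContMDiff (𝓡 n) ((𝓡 n).prod 𝓘(ℝ, F)) ∞ (fun x ↦ TotalSpace.mk' F x (σ x)))
  [RiemannianBundle (fun x : M ↦ TangentSpace (𝓡 n) x)]
  [IsContMDiffRiemannianBundle (𝓡 n) ∞ (EuclideanSpace ℝ (Fin n))
    (fun x : M ↦ TangentSpace (𝓡 n) x)]
  [CovariantDerivative.ContMDiffCovariantDerivative cov ∞]

include hσ

/-- This is the metric trace of `(X, Y) ↦ ⟨∇_X σ, ∇_Y σ⟩`, which is continuous on smooth fields. -/
theorem continuous_covNormSq : Continuous (covNormSq cov σ) := by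
  refine continuous_iff_continuousAt.2 fun x₀ ↦ ?_
  have h := continuousAt_trace (fun x ↦ (innerₗ (V x)).compl₁₂ (cov σ x).toLinearMap
    (cov σ x).toLinearMap) x₀ fun X Y hX hY ↦
      (ContMDiffAt.inner_bundle (contMDiffAt_cov_apply cov hσ hX)
        (contMDiffAt_cov_apply cov hσ hY)).continuousAt
  refine h.congr (.of_forall fun x ↦ ?_)
  simp [covNormSq]

theorem continuous_covRadialSq : Continuous (covRadialSq cov σ) := by
  refine continuous_iff_continuousAt.2 fun x₀ ↦ ?_
  have h := continuousAt_trace (fun x ↦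
    (LinearMap.mul ℝ ℝ).compl₁₂ ((innerₗ (V x) (σ x)) ∘ₗ (cov σ x).toLinearMap)
    ((innerₗ (V x) (σ x)) ∘ₗ (cov σ x).toLinearMap)) x₀ fun X Y hX hY ↦
      ((ContMDiffAt.inner_bundle (hσ x₀) (contMDiffAt_cov_apply cov hσ hX)).continuousAt).mul
        (ContMDiffAt.inner_bundle (hσ x₀) (contMDiffAt_cov_apply cov hσ hY)).continuousAt
  refine h.congr (.of_forall fun x ↦ ?_)
  simp [covRadialSq, real_inner_comm, sq]

end

variable [ContMDiffVectorBundle ∞ F V (𝓡 n)] [IsContMDiffRiemannianBundle (𝓡 n) ∞ F V]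
  {σ : Π x : M, V x}
  (hσ : ContMDiff (𝓡 n) ((𝓡 n).prod 𝓘(ℝ, F)) ∞ (fun x ↦ TotalSpace.mk' F x (σ x)))
  {cov : CovariantDerivative (𝓡 n) F V} [FiniteDimensional ℝ F] (hcov : cov.IsMetricCompatible)

include hσ hcov

theorem mvfderiv_norm_sq_apply (x : M) (v : TangentSpace (𝓡 n) x) :
    mvfderiv (𝓡 n) (fun x ↦ ‖σ x‖ ^ 2) x v = 2 * inner ℝ (cov σ x v) (σ x) := by
  classical
  have hd := hσ.mdifferentiableAt (by simp) (x := x)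
  -- Compatibility is stated for vector fields, with no regularity required, so `v` is extended by
  -- zero.
  have := hcov.mvfderiv_inner_eq (Function.update 0 x v) hd hd
  simp only [Function.update_self, real_inner_self_eq_norm_sq] at this
  rw [this, real_inner_comm (σ x) (cov σ x v)]
  ring

theorem cov_radial_apply (K t : ℝ) (x : M) (v : TangentSpace (𝓡 n) x) :
    cov (fun x ↦ (1 + t * Real.exp (K * ‖σ x‖ ^ 2)) • σ x) x v =
      (1 + t * Real.exp (K * ‖σ x‖ ^ 2)) • cov σ x v +
        (2 * K * t * Real.exp (K * ‖σ x‖ ^ 2) * inner ℝ (cov σ x v) (σ x)) • σ x := by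
  have hd := hσ.mdifferentiableAt (by simp) (x := x)
  have ha : MDifferentiableAt (𝓡 n) 𝓘(ℝ, ℝ) (fun x ↦ ‖σ x‖ ^ 2) x :=
    (contMDiff_norm_sq hσ).mdifferentiableAt (by simp)
  have hG : HasDerivAt (fun r : ℝ ↦ 1 + t * Real.exp (K * r))
      (t * (Real.exp (K * ‖σ x‖ ^ 2) * K)) (‖σ x‖ ^ 2) := by
    simpa using ((((hasDerivAt_id (‖σ x‖ ^ 2)).const_mul K).exp).const_mul t).const_add 1
  have hg := hG.hasFDerivAt.hasMFDerivAt.comp x ha.hasMFDerivAt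
  have h := cov.isCovariantDerivativeOnUniv.leibniz (x := x) hd hg.mdifferentiableAt
  have h' := congr($h v)
  have hval : mvfderiv (𝓡 n) ((fun r : ℝ ↦ 1 + t * Real.exp (K * r)) ∘ fun x ↦ ‖σ x‖ ^ 2) x v =
      mvfderiv (𝓡 n) (fun x ↦ ‖σ x‖ ^ 2) x v * (t * (Real.exp (K * ‖σ x‖ ^ 2) * K)) := by
    unfold mvfderiv
    rw [hg.mfderiv]
    rfl
  refine h'.trans ?_
  simp only [add_apply, smul_apply,
    ContinuousLinearMap.smulRight_apply, hval, mvfderiv_norm_sq_apply hσ hcov, Function.comp_apply]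
  congr 2
  ring

end Sections

/-! ### Functions with vanishing differential -/

section LocallyConstant

variable {n : ℕ} {M : Type*} [TopologicalSpace M] [ChartedSpace (EuclideanSpace ℝ (Fin n)) M]
  [IsManifold (𝓡 n) ∞ M]

/-- A differentiable function is constant near a point around which its derivative vanishes. -/
theorem eventually_eq_of_mfderiv_eq_zero {a : M → ℝ} {U : Set M} (hU : IsOpen U)
    (ha : ∀ x ∈ U, HasMFDerivAt (𝓡 n) 𝓘(ℝ, ℝ) a x 0) {x₀ : M} (hx₀ : x₀ ∈ U) :
    ∀ᶠ x in 𝓝 x₀, a x = a x₀ := by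
  set φ := extChartAt (𝓡 n) x₀ with hφ
  have hS : IsOpen (φ.target ∩ φ.symm ⁻¹' U) :=
    (continuousOn_extChartAt_symm x₀).isOpen_inter_preimage (isOpen_extChartAt_target x₀) hU
  have hmem : φ x₀ ∈ φ.target ∩ φ.symm ⁻¹' U :=
    ⟨mem_extChartAt_target x₀, by simpa [hφ, mem_preimage] using hx₀⟩
  obtain ⟨r, hr, hball⟩ := Metric.isOpen_iff.1 hS _ hmem
  have hder : ∀ y ∈ Metric.ball (φ x₀) r, HasFDerivAt (a ∘ φ.symm)
      (0 : EuclideanSpace ℝ (Fin n) →L[ℝ] ℝ) y := by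
    intro y hy
    have h1 := (ha _ (hball hy).2).comp y
      (mdifferentiableAt_extChartAt_symm_of_mem (hball hy).1).hasMFDerivAt
    rw [ContinuousLinearMap.zero_comp] at h1
    exact h1.hasFDerivAt
  have hconst : ∀ y ∈ Metric.ball (φ x₀) r, (a ∘ φ.symm) y = (a ∘ φ.symm) (φ x₀) := fun y hy ↦
    (convex_ball (φ x₀) r).is_const_of_fderivWithin_eq_zero (𝕜 := ℝ)
      (fun z hz ↦ (hder z hz).differentiableAt.differentiableWithinAt)
      (fun z hz ↦ by
        rw [fderivWithin_of_isOpen Metric.isOpen_ball hz, (hder z hz).fderiv])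
      hy (Metric.mem_ball_self hr)
  filter_upwards [extChartAt_source_mem_nhds (I := 𝓡 n) x₀,
    (continuousAt_extChartAt (I := 𝓡 n) x₀).preimage_mem_nhds
      (Metric.ball_mem_nhds (φ x₀) hr)] with x hx hxr
  have h2 := hconst (φ x) hxr
  simp only [Function.comp_apply] at h2
  rwa [φ.left_inv hx, φ.left_inv (mem_extChartAt_source x₀)] at h2

end LocallyConstant

/-! ### Harmonic sections are parallel -/

section Harmonic

variable {n : ℕ} {M : Type*} [TopologicalSpace M] [CompactSpace M]
  [ChartedSpace (EuclideanSpace ℝ (Fin n)) M] [IsManifold (𝓡 n) ∞ M]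
  [MeasurableSpace M] [BorelSpace M]
  [RiemannianBundle (fun x : M ↦ TangentSpace (𝓡 n) x)]
  [IsContMDiffRiemannianBundle (𝓡 n) ∞ (EuclideanSpace ℝ (Fin n))
    (fun x : M ↦ TangentSpace (𝓡 n) x)]
  {F : Type*} [NormedAddCommGroup F] [NormedSpace ℝ F] [FiniteDimensional ℝ F]
  {V : M → Type*} [TopologicalSpace (TotalSpace F V)]
  [∀ x, NormedAddCommGroup (V x)] [∀ x, InnerProductSpace ℝ (V x)]
  [FiberBundle F V] [VectorBundle ℝ F V] [ContMDiffVectorBundle ∞ F V (𝓡 n)]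
  [IsContMDiffRiemannianBundle (𝓡 n) ∞ F V]
  {cov : CovariantDerivative (𝓡 n) F V} (hcov : cov.IsMetricCompatible) {σ : Π x : M, V x}
  (hσ : ContMDiff (𝓡 n) ((𝓡 n).prod 𝓘(ℝ, F)) ∞ (fun x ↦ TotalSpace.mk' F x (σ x)))

include hcov hσ

omit [IsManifold (𝓡 n) ∞ M] [CompactSpace M] [MeasurableSpace M] [BorelSpace M]
  [IsContMDiffRiemannianBundle (𝓡 n) ∞ (EuclideanSpace ℝ (Fin n)) (fun x : M ↦ TangentSpace (𝓡 n) x)] in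
theorem verticalDensity_radial (p q K t : ℝ) (x : M) :
    verticalDensity cov p q (fun x ↦ (1 + t * Real.exp (K * ‖σ x‖ ^ 2)) • σ x) x =
      radialDensity p q K (t, ‖σ x‖, covNormSq cov σ x, covRadialSq cov σ x) := by
  simp only [verticalDensity, verticalMetric, radialDensity, covNormSq, covRadialSq,
    cov_radial_apply hσ hcov]
  set u := 1 + t * Real.exp (K * ‖σ x‖ ^ 2)
  set d := 2 * K * t * Real.exp (K * ‖σ x‖ ^ 2)
  rw [← Finset.mul_sum, norm_smul, mul_pow, Real.norm_eq_abs, sq_abs, ← mul_pow]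
  congr 1
  rw [Finset.mul_sum, Finset.mul_sum, ← Finset.sum_add_distrib]
  refine Finset.sum_congr rfl fun i _ ↦ ?_
  set w := cov σ x (stdOrthonormalBasis ℝ (TangentSpace (𝓡 n) x) i)
  simp only [inner_add_left, inner_add_right, real_inner_smul_left, real_inner_smul_right,
    real_inner_self_eq_norm_sq, real_inner_comm w (σ x), norm_smul, mul_pow, Real.norm_eq_abs,
    sq_abs]
  ring

/-- The first variation integrates a continuous nonnegative function, which must vanish pointwise;
so does each of its two nonnegative summands. The conclusion keeps the one with `|∇σ|²`. -/
theorem first_variation_eq_zero [CovariantDerivative.ContMDiffCovariantDerivative cov ∞]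
    {p q ν : ℝ} (hν : 1 ≤ ν) (hq : cutoff ν p ≤ q) (h : IsQRiemannian (ν * (1 - p)) σ)
    (hh : IsPQHarmonic cov p q σ) (x : M) :
    (1 + (1 - p) * ‖σ x‖ ^ 2) * covNormSq cov σ x = 0 := by
  have := isFiniteMeasure_riemannianVolume n M
  have := isOpenPosMeasure_riemannianVolume n M
  set K := 2 * |q|
  have hasq := contMDiff_norm_sq hσ
  have hnorm : Continuous fun x ↦ ‖σ x‖ := by
    simpa only [Function.comp_def, Real.sqrt_sq (norm_nonneg _)] using
      Real.continuous_sqrt.comp hasq.continuous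
  have hf : ContMDiff (𝓡 n) 𝓘(ℝ, ℝ) ∞ fun x ↦ Real.exp (K * ‖σ x‖ ^ 2) :=
    (Real.contDiff_exp.comp (contDiff_const.mul contDiff_id)).contMDiff.comp hasq
  have hE := hh _ (isSmoothVariation_radial hσ hf)
  have hb := continuous_covNormSq cov hσ
  have hc := continuous_covRadialSq cov hσ
  have hy : Continuous fun x ↦ (‖σ x‖, covNormSq cov σ x, covRadialSq cov σ x) :=
    hnorm.prodMk (hb.prodMk hc)
  have hE' := (hasDerivAt_integral_of_contDiff (riemannianVolume n M)
    (contDiff_radialDensity p q K) hy).const_mul (1 / 2)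
  simp only [verticalEnergy, verticalDensity_radial hcov hσ] at hE
  have h0 : ∫ x, deriv (fun t ↦ radialDensity p q K
      (t, ‖σ x‖, covNormSq cov σ x, covRadialSq cov σ x)) 0 ∂(riemannianVolume n M) = 0 := by
    have := hE'.unique hE
    linarith
  simp only [deriv_radialDensity] at h0
  have hest := fun x ↦ cutoff_estimates (sq_nonneg ‖σ x‖) hν hq (h x)
  have hB := covNormSq_nonneg cov σ
  have hC := covRadialSq_nonneg cov σ
  have hpos : ∀ x, 0 < (1 / (1 + ‖σ x‖ ^ 2)) ^ (p + 1) := fun x ↦ by positivity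
  have hzero := eq_zero_of_integral_eq_zero (riemannianVolume n M) (g := fun x ↦
      2 * Real.exp (K * ‖σ x‖ ^ 2) * ((1 / (1 + ‖σ x‖ ^ 2)) ^ (p + 1) *
        ((1 + (1 - p) * ‖σ x‖ ^ 2) * covNormSq cov σ x +
          (2 * K * (1 + ‖σ x‖ ^ 2) * (1 + q * ‖σ x‖ ^ 2) + q * (2 + (2 - p) * ‖σ x‖ ^ 2)) *
            covRadialSq cov σ x)))
    (by
      have hw : Continuous fun x ↦ (1 / (1 + ‖σ x‖ ^ 2)) ^ (p + 1) :=
        Continuous.rpow_const (continuous_const.div (by fun_prop) fun x ↦ by positivity)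
          fun x ↦ Or.inl (by positivity)
      fun_prop)
    (fun x ↦ mul_nonneg (by positivity) (mul_nonneg (hpos x).le (add_nonneg
      (mul_nonneg (hest x).1 (hB x)) (mul_nonneg (hest x).2.2 (hC x))))) h0 x
  have h1 := (mul_eq_zero.1 hzero).resolve_left (by positivity)
  have h2 := (mul_eq_zero.1 h1).resolve_left (hpos x).ne'
  have h3 := mul_nonneg (hest x).1 (hB x)
  have h4 := mul_nonneg (hest x).2.2 (hC x)
  linarith

theorem isParallel_of_isPQHarmonic [ConnectedSpace M]
    [CovariantDerivative.ContMDiffCovariantDerivative cov ∞] {p q ν : ℝ} (hq : cutoff ν p ≤ q)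
    (h : (1 < ν ∧ IsQRiemannian (ν * (1 - p)) σ) ∨ (ν = 1 ∧ IsStrictlyQRiemannian (1 - p) σ))
    (hh : IsPQHarmonic cov p q σ) : IsParallel cov σ := by
  -- Where this factor is positive, the vanishing product gives `∇σ = 0`.
  suffices hpos : ∀ x, 0 < 1 + (1 - p) * ‖σ x‖ ^ 2 by
    have hν : 1 ≤ ν ∧ IsQRiemannian (ν * (1 - p)) σ := by
      rcases h with ⟨h1, h2⟩ | ⟨rfl, h2⟩
      · exact ⟨h1.le, h2⟩
      · exact ⟨le_rfl, by simpa using h2.1⟩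
    exact fun x ↦ cov_eq_zero_of_covNormSq_eq_zero cov ((mul_eq_zero.1
      (first_variation_eq_zero hcov hσ hν.1 hq hν.2 hh x)).resolve_left (hpos x).ne')
  rcases h with ⟨h1, h2⟩ | ⟨rfl, h2, x₀, hx₀⟩
  · exact fun x ↦ (cutoff_estimates (sq_nonneg _) h1.le hq (h2 x)).2.1 h1
  have hz := first_variation_eq_zero hcov hσ le_rfl hq (by simpa using h2) hh
  have hasq := contMDiff_norm_sq hσ
  set U : Set M := {x | 0 < 1 + (1 - p) * ‖σ x‖ ^ 2}
  have hU : IsOpen U :=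
    isOpen_lt continuous_const (continuous_const.add (continuous_const.mul hasq.continuous))
  have hder : ∀ x ∈ U, HasMFDerivAt (𝓡 n) 𝓘(ℝ, ℝ) (fun x ↦ ‖σ x‖ ^ 2) x 0 := by
    intro x hx
    have h0 : cov σ x = 0 := cov_eq_zero_of_covNormSq_eq_zero cov
      ((mul_eq_zero.1 (hz x)).resolve_left hx.ne')
    have h1 : mfderiv (𝓡 n) 𝓘(ℝ, ℝ) (fun x ↦ ‖σ x‖ ^ 2) x = 0 := by
      ext v
      have := mvfderiv_norm_sq_apply hσ hcov x v
      rw [h0, zero_apply, inner_zero_left, mul_zero] at this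
      exact this
    rw [← h1]
    exact (hasq.mdifferentiableAt (by simp)).hasMFDerivAt
  have hx₀U : x₀ ∈ U := by
    simp only [U, mem_ofPred_eq]
    linarith
  -- Membership in `U` depends only on `|σ|²`, so the whole level set through `x₀` lies in `U`,
  -- where `|σ|²` is locally constant. This makes the level set open.
  have hclopen : IsClopen {x | ‖σ x‖ ^ 2 = ‖σ x₀‖ ^ 2} := by
    refine ⟨isClosed_eq hasq.continuous continuous_const, isOpen_iff_mem_nhds.2 fun x hx ↦ ?_⟩
    have hx' : ‖σ x‖ ^ 2 = ‖σ x₀‖ ^ 2 := hx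
    have hxU : x ∈ U := by
      simp only [U, mem_ofPred_eq, hx']
      exact hx₀U
    filter_upwards [eventually_eq_of_mfderiv_eq_zero hU hder hxU] with y hy
    exact hy.trans hx'
  have huniv := hclopen.eq_univ ⟨x₀, rfl⟩
  intro x
  have hx : ‖σ x‖ ^ 2 = ‖σ x₀‖ ^ 2 := huniv.symm.subset (mem_univ x)
  rw [hx]
  exact hx₀U

end Harmonic

/-! ### Lipschitz dependence on the parameter -/

section Coefficients

variable {n : ℕ} {M : Type*} [TopologicalSpace M] [ChartedSpace (EuclideanSpace ℝ (Fin n)) M]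
  [IsManifold (𝓡 n) ∞ M]
  [RiemannianBundle (fun x : M ↦ TangentSpace (𝓡 n) x)]
  [IsContMDiffRiemannianBundle (𝓡 n) ∞ (EuclideanSpace ℝ (Fin n))
    (fun x : M ↦ TangentSpace (𝓡 n) x)]

/-- A smooth function of a point and a parameter, and its differential with respect to the point,
are locally Lipschitz in the parameter. -/
theorem exists_lipschitz_parameter {c : M × ℝ → ℝ} {x₀ : M}
    (hc : ContMDiffAt ((𝓡 n).prod 𝓘(ℝ, ℝ)) 𝓘(ℝ, ℝ) ∞ c (x₀, 0)) :
    ∃ C : ℝ, ∀ᶠ z : M × ℝ in 𝓝 (x₀, 0),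
      MDifferentiableAt (𝓡 n) 𝓘(ℝ, ℝ) (fun x ↦ c (x, z.2)) z.1 ∧
      |c z - c (z.1, 0)| ≤ C * |z.2| ∧
      ∀ v : TangentSpace (𝓡 n) z.1, |mvfderiv (𝓡 n) (fun x ↦ c (x, z.2)) z.1 v -
        mvfderiv (𝓡 n) (fun x ↦ c (x, 0)) z.1 v| ≤ C * |z.2| * ‖v‖ := by
  have := isContinuousRiemannianBundle_tangentSpace n M
  set E := EuclideanSpace ℝ (Fin n)
  set φ := extChartAt (𝓡 n) x₀ with hφ
  set g : E × ℝ → ℝ := fun y ↦ c (φ.symm y.1, y.2) with hg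
  have hgs : ContDiffAt ℝ ∞ g (φ x₀, 0) := by
    have h1 : ContMDiffAt (𝓘(ℝ, E).prod 𝓘(ℝ, ℝ)) ((𝓡 n).prod 𝓘(ℝ, ℝ)) ∞
        (fun y : E × ℝ ↦ (φ.symm y.1, y.2)) (φ x₀, 0) :=
      (((contMDiffOn_extChartAt_symm x₀).contMDiffAt (extChartAt_target_mem_nhds x₀)).comp
        (φ x₀, (0 : ℝ)) contMDiffAt_fst).prodMk contMDiffAt_snd
    have h2 : (φ.symm (φ x₀), (0 : ℝ)) = (x₀, 0) := by
      rw [φ.left_inv (mem_extChartAt_source x₀)]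
    have h3 := ContMDiffAt.comp (φ x₀, (0 : ℝ)) (h2 ▸ hc) h1
    rw [← modelWithCornersSelf_prod, chartedSpaceSelf_prod] at h3
    exact h3.contDiffAt
  obtain ⟨K₁, S₁, hS₁, hL₁⟩ := (hgs.of_le (m := 1) (by simp)).exists_lipschitzOnWith
  obtain ⟨K₂, S₂, hS₂, hL₂⟩ :=
    ((hgs.fderiv_right (m := ∞) (by simp)).of_le (m := 1) (by simp)).exists_lipschitzOnWith
  -- The differential of the chart is the trivialization of the tangent bundle. Its local norm bound
  -- turns coordinate estimates into estimates in the Riemannian norm of `v`.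
  obtain ⟨C, hC0, hC⟩ := eventually_norm_trivializationAt_lt E
    (fun x : M ↦ TangentSpace (𝓡 n) x) x₀
  have hdiff : ∀ᶠ y in 𝓝 (φ x₀, (0 : ℝ)), DifferentiableAt ℝ g y :=
    ((hgs.of_le (m := 1) (by simp)).eventually (by simp)).mono
      fun y hy ↦ hy.differentiableAt one_ne_zero
  have hφc : ContinuousAt φ x₀ := continuousAt_extChartAt x₀
  have ht1 : Tendsto (fun z : M × ℝ ↦ (φ z.1, z.2)) (𝓝 (x₀, 0)) (𝓝 (φ x₀, 0)) :=
    (ContinuousAt.prodMk (hφc.comp continuousAt_fst) continuousAt_snd :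
      ContinuousAt (fun z : M × ℝ ↦ (φ z.1, z.2)) (x₀, 0))
  have ht0 : Tendsto (fun z : M × ℝ ↦ (φ z.1, (0 : ℝ))) (𝓝 (x₀, 0)) (𝓝 (φ x₀, 0)) :=
    (ContinuousAt.prodMk (hφc.comp continuousAt_fst) continuousAt_const :
      ContinuousAt (fun z : M × ℝ ↦ (φ z.1, (0 : ℝ))) (x₀, 0))
  have hfst : Tendsto (Prod.fst : M × ℝ → M) (𝓝 (x₀, 0)) (𝓝 x₀) := continuous_fst.tendsto _
  have hsrc : ∀ᶠ x in 𝓝 x₀, x ∈ φ.source := extChartAt_source_mem_nhds x₀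
  have hder : ∀ (x : M) (t : ℝ), x ∈ φ.source → DifferentiableAt ℝ g (φ x, t) →
      HasMFDerivAt (𝓡 n) 𝓘(ℝ, ℝ) (fun x ↦ c (x, t)) x
        (((fderiv ℝ g (φ x, t)).comp (ContinuousLinearMap.inl ℝ E ℝ)).comp
          (mfderiv (𝓡 n) 𝓘(ℝ, E) φ x)) := by
    intro x t hx hd
    have h1 : HasFDerivAt (fun y : E ↦ g (y, t))
        ((fderiv ℝ g (φ x, t)).comp (ContinuousLinearMap.inl ℝ E ℝ)) (φ x) :=
      HasFDerivAt.comp (g := g) (f := fun y : E ↦ (y, t)) (φ x) hd.hasFDerivAt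
        (hasFDerivAt_prodMk_left (φ x) t)
    have h2 : MDifferentiableAt (𝓡 n) 𝓘(ℝ, E) φ x :=
      mdifferentiableAt_extChartAt (by simpa [hφ] using hx)
    refine (h1.hasMFDerivAt.comp x h2.hasMFDerivAt).congr_of_eventuallyEq ?_
    filter_upwards [(isOpen_extChartAt_source x₀).mem_nhds hx] with y hy
    simp only [hg, Function.comp_apply, hφ]
    rw [(extChartAt (𝓡 n) x₀).left_inv hy]
  refine ⟨max K₁ (K₂ * C), ?_⟩
  filter_upwards [ht1.eventually hdiff, ht0.eventually hdiff, ht1.eventually hS₁,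
    ht0.eventually hS₁, ht1.eventually hS₂, ht0.eventually hS₂, hfst.eventually hC,
    hfst.eventually hsrc] with z hd1 hd0 hz1 hz1' hz2 hz2' hzC hzs
  have hnorm : ‖((φ z.1, z.2) : E × ℝ) - (φ z.1, 0)‖ = |z.2| := by
    simp [Prod.norm_def]
  have hm1 := hder z.1 z.2 hzs hd1
  have hm0 := hder z.1 0 hzs hd0
  refine ⟨hm1.mdifferentiableAt, ?_, fun v ↦ ?_⟩
  · have := hL₁.norm_sub_le hz1 hz1'
    rw [hnorm] at this
    simp only [hg, φ.left_inv hzs, Real.norm_eq_abs] at this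
    exact this.trans (mul_le_mul_of_nonneg_right (le_max_left _ _) (abs_nonneg _))
  · have h1 := hL₂.norm_sub_le hz2 hz2'
    rw [hnorm] at h1
    set A := (trivializationAt E (fun x : M ↦ TangentSpace (𝓡 n) x) x₀).continuousLinearMapAt ℝ z.1
      with hA
    have hAm : A = mfderiv (𝓡 n) 𝓘(ℝ, E) φ z.1 :=
      TangentBundle.continuousLinearMapAt_trivializationAt (by simpa [hφ] using hzs)
    have h2 : mvfderiv (𝓡 n) (fun x ↦ c (x, z.2)) z.1 v = fderiv ℝ g (φ z.1, z.2) (A v, 0) := by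
      unfold mvfderiv
      rw [hm1.mfderiv, hAm]
      rfl
    have h3 : mvfderiv (𝓡 n) (fun x ↦ c (x, 0)) z.1 v = fderiv ℝ g (φ z.1, 0) (A v, 0) := by
      unfold mvfderiv
      rw [hm0.mfderiv, hAm]
      rfl
    have h4 : ‖((A v, 0) : E × ℝ)‖ ≤ C * ‖v‖ := by
      rw [Prod.norm_def, norm_zero, max_eq_left (norm_nonneg _)]
      exact A.le_of_opNorm_le hzC.le v
    rw [h2, h3, ← sub_apply, ← Real.norm_eq_abs]
    calc _ ≤ ‖fderiv ℝ g (φ z.1, z.2) - fderiv ℝ g (φ z.1, 0)‖ * ‖((A v, 0) : E × ℝ)‖ :=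
          ContinuousLinearMap.le_opNorm _ _
      _ ≤ (K₂ * |z.2|) * (C * ‖v‖) := by gcongr
      _ = K₂ * C * |z.2| * ‖v‖ := by ring
      _ ≤ _ := by gcongr; exact le_max_right _ _

end Coefficients

/-! ### Global extensions of local sections and the Leibniz rule for sums -/

section Frames

variable {n : ℕ} {M : Type*} [TopologicalSpace M] [T2Space M]
  [ChartedSpace (EuclideanSpace ℝ (Fin n)) M]
  {F : Type*} [NormedAddCommGroup F] [NormedSpace ℝ F]
  {V : M → Type*} [TopologicalSpace (TotalSpace F V)]
  [∀ x, NormedAddCommGroup (V x)] [∀ x, InnerProductSpace ℝ (V x)]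
  [FiberBundle F V] [VectorBundle ℝ F V]

/-- A section which is smooth near `x₀` agrees near `x₀` with a smooth section. -/
theorem exists_contMDiff_section_eventuallyEq [IsManifold (𝓡 n) ∞ M] {U : Set M}
    (hU : IsOpen U) {x₀ : M} (hx₀ : x₀ ∈ U) {τ : Π x : M, V x}
    (hτ : ContMDiffOn (𝓡 n) ((𝓡 n).prod 𝓘(ℝ, F)) ∞ (fun x ↦ TotalSpace.mk' F x (τ x)) U) :
    ∃ τ' : Π x : M, V x,
      ContMDiff (𝓡 n) ((𝓡 n).prod 𝓘(ℝ, F)) ∞ (fun x ↦ TotalSpace.mk' F x (τ' x)) ∧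
      ∀ᶠ x in 𝓝 x₀, τ' x = τ x := by
  obtain ⟨ψ, -, hψ⟩ := (SmoothBumpFunction.nhds_basis_tsupport (I := 𝓡 n) x₀).mem_iff.1
    (hU.mem_nhds hx₀)
  refine ⟨(ψ : M → ℝ) • τ, ψ.contMDiff.contMDiffOn.smul_section_of_tsupport hU hψ hτ, ?_⟩
  filter_upwards [ψ.eventuallyEq_one] with x hx
  simp [hx]

omit [T2Space M] in
theorem cov_sum_smul (cov : CovariantDerivative (𝓡 n) F V) {ι : Type*} (S : Finset ι)
    (g : ι → M → ℝ) (τ : ι → Π x : M, V x) {x : M}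
    (hg : ∀ i ∈ S, MDifferentiableAt (𝓡 n) 𝓘(ℝ, ℝ) (g i) x)
    (hτ : ∀ i ∈ S, MDifferentiableAt (𝓡 n) ((𝓡 n).prod 𝓘(ℝ, F))
      (fun y ↦ TotalSpace.mk' F y (τ i y)) x) (v : TangentSpace (𝓡 n) x) :
    cov (fun y ↦ ∑ i ∈ S, g i y • τ i y) x v =
      ∑ i ∈ S, (g i x • cov (τ i) x v + mvfderiv (𝓡 n) (g i) x v • τ i x) := by
  classical
  induction S using Finset.induction_on with
  | empty =>
    simp only [Finset.sum_empty]
    have := congr_fun cov.zero x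
    exact congr($this v)
  | insert j S hj ih =>
    have hj1 := hg j (Finset.mem_insert_self j S)
    have hj2 := hτ j (Finset.mem_insert_self j S)
    have h1 : MDifferentiableAt (𝓡 n) ((𝓡 n).prod 𝓘(ℝ, F))
        (fun y ↦ TotalSpace.mk' F y ((g j • τ j) y)) x := hj1.smul_section hj2
    have h2 : MDifferentiableAt (𝓡 n) ((𝓡 n).prod 𝓘(ℝ, F))
        (fun y ↦ TotalSpace.mk' F y (∑ i ∈ S, g i y • τ i y)) x :=
      MDifferentiableAt.sum_section fun i hi ↦ (hg i (Finset.mem_insert_of_mem hi)).smul_section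
        (hτ i (Finset.mem_insert_of_mem hi))
    have h3 : (fun y ↦ ∑ i ∈ insert j S, g i y • τ i y) =
        (g j • τ j) + fun y ↦ ∑ i ∈ S, g i y • τ i y := by
      ext y
      simp [Finset.sum_insert hj]
    rw [h3, cov.isCovariantDerivativeOnUniv.add h1 h2,
      cov.isCovariantDerivativeOnUniv.leibniz hj2 hj1, Finset.sum_insert hj, add_apply,
      ih (fun i hi ↦ hg i (Finset.mem_insert_of_mem hi))
        fun i hi ↦ hτ i (Finset.mem_insert_of_mem hi)]
    simp

end Frames

/-! ### Parallel sections are harmonic -/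

section Variation

variable {n : ℕ} {M : Type*} [TopologicalSpace M] [T2Space M]
  [ChartedSpace (EuclideanSpace ℝ (Fin n)) M] [IsManifold (𝓡 n) ∞ M]
  [RiemannianBundle (fun x : M ↦ TangentSpace (𝓡 n) x)]
  [IsContMDiffRiemannianBundle (𝓡 n) ∞ (EuclideanSpace ℝ (Fin n))
    (fun x : M ↦ TangentSpace (𝓡 n) x)]
  {F : Type*} [NormedAddCommGroup F] [NormedSpace ℝ F] [FiniteDimensional ℝ F]
  {V : M → Type*} [TopologicalSpace (TotalSpace F V)]
  [∀ x, NormedAddCommGroup (V x)] [∀ x, InnerProductSpace ℝ (V x)]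
  [FiberBundle F V] [VectorBundle ℝ F V] [ContMDiffVectorBundle ∞ F V (𝓡 n)]
  [IsContMDiffRiemannianBundle (𝓡 n) ∞ F V]
  {cov : CovariantDerivative (𝓡 n) F V} [CovariantDerivative.ContMDiffCovariantDerivative cov ∞]
  {σ : Π x : M, V x} {s : ℝ → Π x : M, V x}

/-- The covariant derivative of a smooth variation is locally Lipschitz at time `0`. -/
theorem exists_norm_cov_sub_le (hs : IsSmoothVariation F n σ s) (x₀ : M) :
    ∃ C : ℝ, ∀ᶠ z : M × ℝ in 𝓝 (x₀, 0),
      ∀ k, ‖cov (s z.2) z.1 (stdOrthonormalBasis ℝ (TangentSpace (𝓡 n) z.1) k) -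
        cov (s 0) z.1 (stdOrthonormalBasis ℝ (TangentSpace (𝓡 n) z.1) k)‖ ≤ C * |z.2| := by
  classical
  set e := trivializationAt F V x₀
  set b := Module.finBasis ℝ F
  have hx₀ : x₀ ∈ e.baseSet := FiberBundle.mem_baseSet_trivializationAt' x₀
  have hfr := e.isLocalFrameOn_localFrame_baseSet (𝓡 n) ∞ b
  -- The frame is replaced by globally smooth sections because the continuity of `covNormSq` is
  -- established for those only.
  choose τ hτ hτe using fun i ↦
    exists_contMDiff_section_eventuallyEq e.open_baseSet hx₀ (hfr.contMDiffOn i)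
  set c : Fin (Module.finrank ℝ F) → M × ℝ → ℝ := fun i z ↦ b.repr (e ⟨z.1, s z.2 z.1⟩).2 i with hc
  have hcs : ∀ i, ContMDiffAt ((𝓡 n).prod 𝓘(ℝ, ℝ)) 𝓘(ℝ, ℝ) ∞ (c i) (x₀, 0) := fun i ↦ by
    have h1 := (contMDiffAt_totalSpace.1 (hs.2 (x₀, 0))).2
    have h2 : ContDiff ℝ ∞ (LinearMap.toContinuousLinearMap (b.coord i)) :=
      ContinuousLinearMap.contDiff _
    exact h2.contMDiff.contMDiffAt.comp (x₀, (0 : ℝ)) h1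
  choose C hC using fun i ↦ exists_lipschitz_parameter (hcs i)
  have hsd : ∀ t x, MDifferentiableAt (𝓡 n) ((𝓡 n).prod 𝓘(ℝ, F))
      (fun y ↦ TotalSpace.mk' F y (s t y)) x := fun t x ↦ by
    have h1 : ContMDiffAt (𝓡 n) ((𝓡 n).prod 𝓘(ℝ, ℝ)) ∞ (fun y : M ↦ (y, t)) x :=
      contMDiffAt_id.prodMk contMDiffAt_const
    exact ((hs.2 (x, t)).comp x h1).mdifferentiableAt (by simp)
  have hexp : ∀ᶠ x in 𝓝 x₀, ∀ t, s t x = ∑ i, c i (x, t) • τ i x := by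
    filter_upwards [eventually_all.2 hτe, e.open_baseSet.mem_nhds hx₀] with x hx hxb t
    simp only [hx]
    refine (Trivialization.eq_sum_localFrameCoeff_smul (I := 𝓡 n) (b := b) (s := s t) hxb).trans ?_
    exact Finset.sum_congr rfl fun i _ ↦ by
      rw [Trivialization.localFrameCoeff_eq_coeff (I := 𝓡 n) (b := b) (s := s t) e hxb]
  have hcov : ∀ x t, (∀ᶠ y in 𝓝 x, ∀ t, s t y = ∑ i, c i (y, t) • τ i y) →
      (∀ i, MDifferentiableAt (𝓡 n) 𝓘(ℝ, ℝ) (fun y ↦ c i (y, t)) x) →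
      ∀ v, cov (s t) x v = ∑ i, (c i (x, t) • cov (τ i) x v +
        mvfderiv (𝓡 n) (fun y ↦ c i (y, t)) x v • τ i x) := by
    intro x t hx hcx v
    have hτd : ∀ i, MDifferentiableAt (𝓡 n) ((𝓡 n).prod 𝓘(ℝ, F))
        (fun y ↦ TotalSpace.mk' F y (τ i y)) x := fun i ↦ (hτ i).mdifferentiableAt (by simp)
    rw [← cov_sum_smul cov Finset.univ (fun i y ↦ c i (y, t)) τ (fun i _ ↦ hcx i)
      (fun i _ ↦ hτd i) v]
    have h1 : MDifferentiableAt (𝓡 n) ((𝓡 n).prod 𝓘(ℝ, F))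
        (fun y ↦ TotalSpace.mk' F y (∑ i, c i (y, t) • τ i y)) x :=
      MDifferentiableAt.sum_section fun i _ ↦ (hcx i).smul_section (hτd i)
    rw [cov.isCovariantDerivativeOnUniv.congr_of_eventuallyEq (hsd t x) h1 univ_mem
      (hx.mono fun y hy ↦ hy t)]
  have hfst : Tendsto (Prod.fst : M × ℝ → M) (𝓝 (x₀, 0)) (𝓝 x₀) := continuous_fst.tendsto _
  have hpair : Tendsto (fun z : M × ℝ ↦ (z.1, (0 : ℝ))) (𝓝 (x₀, 0)) (𝓝 (x₀, 0)) :=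
    (continuous_fst.prodMk continuous_const).tendsto _
  have hB1 : ∀ i, ∀ᶠ x in 𝓝 x₀, covNormSq cov (τ i) x < covNormSq cov (τ i) x₀ + 1 := fun i ↦
    (continuous_covNormSq cov (hτ i)).continuousAt.eventually_lt continuousAt_const (lt_add_one _)
  have hB2 : ∀ i, ∀ᶠ x in 𝓝 x₀, ‖τ i x‖ ^ 2 < ‖τ i x₀‖ ^ 2 + 1 := fun i ↦
    (contMDiff_norm_sq (hτ i)).continuous.continuousAt.eventually_lt continuousAt_const
      (lt_add_one _)
  -- The two terms bound the change of `cᵢ ∇τᵢ` and of `dcᵢ ⊗ τᵢ`; the `+ 1` leaves room for moving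
  -- away from `x₀`.
  refine ⟨∑ i, (C i * √(covNormSq cov (τ i) x₀ + 1) + C i * √(‖τ i x₀‖ ^ 2 + 1)), ?_⟩
  filter_upwards [hfst.eventually (eventually_eventually_nhds.2 hexp), eventually_all.2 hC,
    hpair.eventually (eventually_all.2 hC), hfst.eventually (eventually_all.2 hB1),
    hfst.eventually (eventually_all.2 hB2)] with z hz hzC hzC0 hz1 hz2 k
  set v := stdOrthonormalBasis ℝ (TangentSpace (𝓡 n) z.1) k with hv
  have hv1 : ‖v‖ = 1 := (stdOrthonormalBasis ℝ (TangentSpace (𝓡 n) z.1)).orthonormal.1 k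
  rw [hcov z.1 z.2 hz (fun i ↦ (hzC i).1) v, hcov z.1 0 hz (fun i ↦ (hzC0 i).1) v,
    ← Finset.sum_sub_distrib, Finset.sum_mul]
  refine norm_sum_le_of_le _ fun i _ ↦ ?_
  obtain ⟨-, h1, h2⟩ := hzC i
  have h3 := h2 v
  rw [hv1, mul_one] at h3
  have h4 : ‖cov (τ i) z.1 v‖ ≤ √(covNormSq cov (τ i) x₀ + 1) :=
    Real.le_sqrt_of_sq_le ((norm_cov_sq_le_covNormSq cov (τ i) z.1 k).trans (hz1 i).le)
  have h5 : ‖τ i z.1‖ ≤ √(‖τ i x₀‖ ^ 2 + 1) := Real.le_sqrt_of_sq_le (hz2 i).le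
  have h6 : c i (z.1, z.2) • cov (τ i) z.1 v + mvfderiv (𝓡 n) (fun y ↦ c i (y, z.2)) z.1 v • τ i z.1
      - (c i (z.1, 0) • cov (τ i) z.1 v + mvfderiv (𝓡 n) (fun y ↦ c i (y, 0)) z.1 v • τ i z.1) =
      (c i z - c i (z.1, 0)) • cov (τ i) z.1 v +
        (mvfderiv (𝓡 n) (fun y ↦ c i (y, z.2)) z.1 v -
          mvfderiv (𝓡 n) (fun y ↦ c i (y, 0)) z.1 v) • τ i z.1 := by
    rw [sub_smul, sub_smul]
    abel
  rw [h6]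
  refine (norm_add_le _ _).trans ?_
  rw [norm_smul, norm_smul, Real.norm_eq_abs, Real.norm_eq_abs]
  calc _ ≤ C i * |z.2| * √(covNormSq cov (τ i) x₀ + 1) + C i * |z.2| * √(‖τ i x₀‖ ^ 2 + 1) :=
        add_le_add (mul_le_mul h1 h4 (norm_nonneg _) ((abs_nonneg _).trans h1))
          (mul_le_mul h3 h5 (norm_nonneg _) ((abs_nonneg _).trans h3))
    _ = _ := by ring

theorem abs_verticalMetric_self_le {W : Type*} [NormedAddCommGroup W] [InnerProductSpace ℝ W]
    (p q : ℝ) (e a : W) :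
    |verticalMetric p q e a a| ≤ (1 / (1 + ‖e‖ ^ 2)) ^ p * (1 + |q| * ‖e‖ ^ 2) * ‖a‖ ^ 2 := by
  have hw : 0 ≤ (1 / (1 + ‖e‖ ^ 2)) ^ p := by positivity
  rw [verticalMetric, abs_mul, abs_of_nonneg hw,
    mul_assoc ((1 / (1 + ‖e‖ ^ 2)) ^ p) (1 + |q| * ‖e‖ ^ 2)]
  refine mul_le_mul_of_nonneg_left ?_ hw
  have h1 : |inner ℝ a e| * |inner ℝ a e| ≤ (‖a‖ * ‖e‖) * (‖a‖ * ‖e‖) :=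
    mul_self_le_mul_self (abs_nonneg _) (abs_real_inner_le_norm a e)
  have h2 : |q * inner ℝ a e * inner ℝ a e| ≤ |q| * ((‖a‖ * ‖e‖) * (‖a‖ * ‖e‖)) := by
    rw [mul_assoc, abs_mul, abs_mul]
    exact mul_le_mul_of_nonneg_left h1 (abs_nonneg q)
  refine (abs_add_le _ _).trans ?_
  rw [real_inner_self_eq_norm_sq, abs_of_nonneg (sq_nonneg ‖a‖)]
  linarith

/-- The energy density of a variation of a parallel section is locally quadratically small. -/
theorem exists_abs_verticalDensity_le (hs : IsSmoothVariation F n σ s) (hσ : IsParallel cov σ)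
    (p q : ℝ) (x₀ : M) :
    ∃ C : ℝ, ∀ᶠ z : M × ℝ in 𝓝 (x₀, 0), |verticalDensity cov p q (s z.2) z.1| ≤ C * z.2 ^ 2 := by
  obtain ⟨C, hC⟩ := exists_norm_cov_sub_le (cov := cov) hs x₀
  set H : M × ℝ → ℝ := fun z ↦
    (1 / (1 + ‖s z.2 z.1‖ ^ 2)) ^ p * (1 + |q| * ‖s z.2 z.1‖ ^ 2) with hH
  have hnorm : Continuous fun z : M × ℝ ↦ ‖s z.2 z.1‖ ^ 2 := by
    have := ContMDiff.inner_bundle hs.2 hs.2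
    simp only [real_inner_self_eq_norm_sq] at this
    exact this.continuous
  have hwc : Continuous fun z : M × ℝ ↦ (1 / (1 + ‖s z.2 z.1‖ ^ 2)) ^ p :=
    Continuous.rpow_const (continuous_const.div (by fun_prop) fun z ↦ by positivity)
      fun z ↦ Or.inl (by positivity)
  have hHc : Continuous H := hwc.mul (by fun_prop)
  -- There are `n` orthonormal directions. In each, `|∇s_t| ≤ C|t|` since `∇s₀ = 0`, and the weight
  -- is at most `H (x₀, 0) + 1` near `(x₀, 0)`.
  refine ⟨n * ((H (x₀, 0) + 1) * C ^ 2), ?_⟩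
  filter_upwards [hC, hHc.continuousAt.eventually_lt continuousAt_const (lt_add_one (H (x₀, 0)))]
    with z hz hHz
  have hcard : (Finset.univ : Finset (Fin (Module.finrank ℝ
      (TangentSpace (𝓡 n) z.1)))).card = n := by
    rw [Finset.card_univ, Fintype.card_fin]
    exact finrank_euclideanSpace_fin (𝕜 := ℝ)
  have hterm : ∀ k ∈ (Finset.univ : Finset (Fin (Module.finrank ℝ (TangentSpace (𝓡 n) z.1)))),
      |verticalMetric p q (s z.2 z.1)
        (cov (s z.2) z.1 (stdOrthonormalBasis ℝ (TangentSpace (𝓡 n) z.1) k))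
        (cov (s z.2) z.1 (stdOrthonormalBasis ℝ (TangentSpace (𝓡 n) z.1) k))| ≤
      (H (x₀, 0) + 1) * C ^ 2 * z.2 ^ 2 := by
    intro k _
    have h1 := hz k
    rw [hs.1, hσ z.1, zero_apply, sub_zero] at h1
    have h2 := mul_self_le_mul_self (norm_nonneg _) h1
    refine (abs_verticalMetric_self_le _ _ _ _).trans ?_
    rw [mul_assoc _ (C ^ 2)]
    refine mul_le_mul hHz.le ?_ (sq_nonneg _) ?_
    · rw [sq, ← sq_abs z.2]
      linarith
    · have : 0 ≤ H z := by positivity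
      exact this.trans hHz.le
  calc |verticalDensity cov p q (s z.2) z.1| ≤ ∑ k, _ := Finset.abs_sum_le_sum_abs _ _
    _ ≤ _ := Finset.sum_le_card_nsmul _ _ _ hterm
    _ = _ := by rw [hcard, nsmul_eq_mul]; ring

/-- The local bounds pass to finite unions by taking the larger constant, so compactness makes them
uniform in `x`. -/
theorem exists_forall_abs_verticalDensity_le [CompactSpace M] (hs : IsSmoothVariation F n σ s)
    (hσ : IsParallel cov σ) (p q : ℝ) :
    ∃ C : ℝ, ∀ᶠ t in 𝓝 (0 : ℝ), ∀ x, |verticalDensity cov p q (s t) x| ≤ C * t ^ 2 := by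
  have : ∃ C : ℝ, ∀ᶠ t in 𝓝 (0 : ℝ), ∀ x ∈ (univ : Set M),
      |verticalDensity cov p q (s t) x| ≤ C * t ^ 2 := by
    refine isCompact_univ.induction_on
      (p := fun S : Set M ↦ ∃ C : ℝ, ∀ᶠ t in 𝓝 (0 : ℝ), ∀ x ∈ S,
        |verticalDensity cov p q (s t) x| ≤ C * t ^ 2) ⟨0, by simp⟩ ?_ ?_ ?_
    · rintro S T hST ⟨C, hC⟩
      exact ⟨C, hC.mono fun t ht x hx ↦ ht x (hST hx)⟩
    · rintro S T ⟨C, hC⟩ ⟨D, hD⟩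
      refine ⟨max C D, ?_⟩
      filter_upwards [hC, hD] with t h1 h2 x hx
      rcases hx with hx | hx
      · exact (h1 x hx).trans (mul_le_mul_of_nonneg_right (le_max_left _ _) (sq_nonneg t))
      · exact (h2 x hx).trans (mul_le_mul_of_nonneg_right (le_max_right _ _) (sq_nonneg t))
    · intro x _
      obtain ⟨C, hC⟩ := exists_abs_verticalDensity_le (cov := cov) hs hσ p q x
      rw [nhds_prod_eq, eventually_prod_iff] at hC
      obtain ⟨P, hP, Q, hQ, h⟩ := hC
      exact ⟨{y | P y}, mem_nhdsWithin_of_mem_nhds hP, C, hQ.mono fun t ht y hy ↦ h hy ht⟩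
  simpa using this

/-- The quadratic bound gives differentiability at zero and the value of the derivative together; no
differentiation under the integral is needed. -/
theorem isPQHarmonic_of_isParallel [CompactSpace M] [MeasurableSpace M] [BorelSpace M]
    (hσ : IsParallel cov σ) (p q : ℝ) : IsPQHarmonic cov p q σ := by
  have := isFiniteMeasure_riemannianVolume n M
  intro s hs
  obtain ⟨C, hC⟩ := exists_forall_abs_verticalDensity_le hs hσ p q
  set m := (riemannianVolume n M).real univ
  have hE : ∀ᶠ t in 𝓝 (0 : ℝ), |verticalEnergy cov p q (s t)| ≤ 1 / 2 * (C * m) * t ^ 2 := by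
    filter_upwards [hC] with t ht
    have h1 := norm_integral_le_of_norm_le_const (μ := riemannianVolume n M)
      (f := verticalDensity cov p q (s t)) (C := C * t ^ 2)
      (.of_forall fun x ↦ by simpa using ht x)
    rw [verticalEnergy, abs_mul, abs_of_pos (by norm_num : (0 : ℝ) < 1 / 2)]
    rw [Real.norm_eq_abs] at h1
    linarith
  have h0 : verticalEnergy cov p q (s 0) = 0 := by
    simpa using hE.self_of_nhds
  rw [hasDerivAt_iff_isLittleO]
  simp only [h0, sub_zero, smul_zero]
  have hO : (fun t ↦ verticalEnergy cov p q (s t)) =O[𝓝 0] fun t : ℝ ↦ t ^ 2 :=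
    Asymptotics.IsBigO.of_bound (1 / 2 * (C * m)) (hE.mono fun t ht ↦ by simpa using ht)
  exact hO.trans_isLittleO (by
    simpa using! Asymptotics.isLittleO_pow_pow (𝕜 := ℝ) (m := 1) (n := 2) (by norm_num))

end Variation

end PQHarmonic

theorem theorem4p6
    {n : ℕ} {M : Type*} [TopologicalSpace M] [T2Space M] [ConnectedSpace M] [CompactSpace M]
    [ChartedSpace (EuclideanSpace ℝ (Fin n)) M] [IsManifold (𝓡 n) ∞ M]
    [MeasurableSpace M] [BorelSpace M]
    [RiemannianBundle (fun x : M ↦ TangentSpace (𝓡 n) x)]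
    [IsContMDiffRiemannianBundle (𝓡 n) ∞ (EuclideanSpace ℝ (Fin n))
      (fun x : M ↦ TangentSpace (𝓡 n) x)]
    {F : Type*} [NormedAddCommGroup F] [NormedSpace ℝ F] [FiniteDimensional ℝ F]
    {V : M → Type*} [TopologicalSpace (TotalSpace F V)]
    [∀ x, NormedAddCommGroup (V x)] [∀ x, InnerProductSpace ℝ (V x)]
    [FiberBundle F V] [VectorBundle ℝ F V] [ContMDiffVectorBundle ∞ F V (𝓡 n)]
    [IsContMDiffRiemannianBundle (𝓡 n) ∞ F V]
    (cov : CovariantDerivative (𝓡 n) F V) [CovariantDerivative.ContMDiffCovariantDerivative cov ∞]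
    (hcov : cov.IsMetricCompatible)
    (σ : Π x : M, V x)
    (hσ : ContMDiff (𝓡 n) ((𝓡 n).prod 𝓘(ℝ, F)) ∞ (fun x ↦ TotalSpace.mk' F x (σ x)))
    (p q ν : ℝ) (hp : -4 ≤ p) (hq : PQHarmonic.cutoff ν p ≤ q)
    (h : (1 < ν ∧ PQHarmonic.IsQRiemannian (ν * (1 - p)) σ) ∨
      (ν = 1 ∧ PQHarmonic.IsStrictlyQRiemannian (1 - p) σ)) :
    PQHarmonic.IsPQHarmonic cov p q σ ↔ PQHarmonic.IsParallel cov σ := by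
  refine ⟨PQHarmonic.isParallel_of_isPQHarmonic hcov hσ hq h, fun hpar ↦ ?_⟩
  exact PQHarmonic.isPQHarmonic_of_isParallel hpar p q
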